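/- Let $\beta\ge 2$ and let $(a_j)_{j\in\mathbb N}$ be positive real numbers decreasing to $0$. On $\mathbb S^2\times\mathbb S^1$, where $\mathbb S^2$ is the unit sphere with polar coordinates $(r,\theta)$, $0\le r\le \pi$, and $\mathbb S^1$ is the circle of length $2\pi$ with coordinate $\varphi$, consider the Riemannian metrics $$g_j=dr^2+\sin^2(r)\,d\theta^2+f_j(r)^2\,d\varphi^2,\qquad f_j(r)=\ln\Big(\frac{1+a_j}{\sin^2 r+a_j}\Big)+\beta,$$ and the product metric $g_0=dr^2+\sin^2(r)\,d\theta^2+d\varphi^2$. Let $S=r^{-1}(0)\cup r^{-1}(\pi)$ and, on $(\mathbb S^2\times\mathbb S^1)\setminus S$, let $$g_\infty=dr^2+\sin^2(r)\,d\theta^2+f_\infty(r)^2\,d\varphi^2,\qquad f_\infty(r)=\ln\Big(\frac1{\sin^2 r}\Big)+\beta .$$ Let $d_j$, $d_0$ (on $\mathbb S^2\times\mathbb S^1$) and $d_{g_\infty}$ (on $(\mathbb S^2\times\mathbb S^1)\setminus S$) be the Riemannian distances, that is, the infima of the lengths of continuously differentiable curves joining two points; for $d_{g_\infty}$ the curves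 have to stay in $(\mathbb S^2\times\mathbb S^1)\setminus S$. Then: 1. For all $p,q$ the sequence $d_j(p,q)$ is increasing in $j$, and $d_\infty(p,q)=\lim_{j\to\infty}d_j(p,q)=\sup_j d_j(p,q)$ exists and is a distance function on $\mathbb S^2\times\mathbb S^1$. 2. $d_j\to d_\infty$ uniformly on $(\mathbb S^2\times\mathbb S^1)^2$, and $(\mathbb S^2\times\mathbb S^1,d_j)\to(\mathbb S^2\times\mathbb S^1,d_\infty)$ in the Gromov–Hausdorff sense. 3. $(\mathbb S^2\times\mathbb S^1,d_\infty)$ is compact, and the identity map $(\mathbb S^2\times\mathbb S^1,d_0)\to(\mathbb S^2\times\mathbb S^1,d_\infty)$ is a homeomorphism. 4. $(\mathbb S^2\times\mathbb S^1,d_\infty)$ is the metric completion of $((\mathbb S^2\times\mathbb S^1)\setminus S,d_{g_\infty})$: it is complete, and the inclusion of $((\mathbb S^2\times\mathbb S^1)\setminus S,d_{g_\infty})$ is distance preserving with dense image. 5. With respect to $d_\infty$, the set $S$ has Hausdorff dimension $1$ and $\mathcal H^1_{d_\infty}(S)=\infty$. Each of the two singular fibres is unrectifiable: for $\rho=0$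 and $\rho=\pi$ one has $\mathcal H^1_{d_\infty}(r^{-1}(\rho))=\infty$, and the curve $t\mapsto(\rho,0,t)$, $0\le t\le 2\pi$, has infinite $d_\infty$-length. 6. $\mathcal H^3_{d_\infty}(\mathbb S^2\times\mathbb S^1)=(2\pi)^2(2\beta+4-2\ln 4)$, where $\mathcal H^3$ is normalized to agree with Lebesgue measure on $\mathbb R^3$. -/

import Mathlib

open Set Filter Topology MeasureTheory

noncomputable section

namespace ExtremeLimit

/-! ### Metric spaces given by a distance function -/

/-- `d` is a (definite, finite) distance function on `X`. -/
structure IsMetric {X : Type} (d : X → X → ℝ) : Prop where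
  dist_self : ∀ x, d x x = 0
  dist_comm : ∀ x y, d x y = d y x
  dist_triangle : ∀ x y z, d x z ≤ d x y + d y z
  eq_of_dist_eq_zero : ∀ {x y}, d x y = 0 → x = y

/-- The metric space `(X, d)`: the set `X` with the metric, the topology and the Borel
`σ`-algebra given by the distance function `d` (and by nothing else that `X` may carry). -/
def Space {X : Type} {d : X → X → ℝ} (_h : IsMetric d) : Type := X

/-- The identity map from the set `X` to the metric space `(X, d)`. -/
def Space.of {X : Type} {d : X → X → ℝ} (h : IsMetric d) : X → Space h := fun x => x

/-- The identity map from the metric space `(X, d)` to the set `X`. -/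
def Space.pt {X : Type} {d : X → X → ℝ} {h : IsMetric d} : Space h → X := fun x => x

instance {X : Type} {d : X → X → ℝ} (h : IsMetric d) : MetricSpace (Space h) where
  dist := fun x y => d x.pt y.pt
  dist_self := h.dist_self
  dist_comm := h.dist_comm
  dist_triangle := h.dist_triangle
  eq_of_dist_eq_zero := h.eq_of_dist_eq_zero

instance {X : Type} {d : X → X → ℝ} (h : IsMetric d) : MeasurableSpace (Space h) :=
  borel (Space h)

instance {X : Type} {d : X → X → ℝ} (h : IsMetric d) : BorelSpace (Space h) := ⟨rfl⟩

instance {X : Type} [Nonempty X] {d : X → X → ℝ} (h : IsMetric d) : Nonempty (Space h) :=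
  inferInstanceAs (Nonempty X)

/-! ### The manifold `S² × S¹` -/

/-- Euclidean three-space. -/
abbrev E3 : Type := EuclideanSpace ℝ (Fin 3)

/-- The manifold `S² × S¹`: the unit sphere of `ℝ³` times the unit circle of `ℂ`. -/
abbrev M : Type := Metric.sphere (0 : E3) 1 × Circle

/-- The coordinate `r` on `S²`: the spherical distance to the north pole `(0, 0, 1)`. -/
def r (p : M) : ℝ := Real.arccos ((p.1 : E3) 2)

/-- The point of `S² × S¹` with coordinates `(r, θ, φ)`. -/
def point (r θ φ : ℝ) : M :=
  (⟨!₂[Real.sin r * Real.cos θ, Real.sin r * Real.sin θ, Real.cos r], by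
      rw [mem_sphere_zero_iff_norm, EuclideanSpace.norm_eq, Real.sqrt_eq_one]
      simp only [Real.norm_eq_abs, sq_abs, Fin.sum_univ_three, Matrix.cons_val]
      nlinarith [Real.sin_sq_add_cos_sq r, Real.sin_sq_add_cos_sq θ]⟩,
    Circle.exp φ)

instance : Nonempty M := ⟨point 0 0 0⟩

/-- The circle fibre `r⁻¹(ρ)`, used for `ρ = 0` and `ρ = π`. -/
def fibre (ρ : ℝ) : Set M := {p | r p = ρ}

/-- The singular set `S = r⁻¹(0) ∪ r⁻¹(π)`. -/
def S : Set M := fibre 0 ∪ fibre Real.pi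

/-! ### Warped product metrics, lengths and Riemannian distances -/

/-- The warped product metric tensor `g = g_{S²} + f(r)² g_{S¹}` at `p`, that is
`dr² + sin²(r) dθ² + f(r)² dφ²`. Tangent vectors are written as vectors of `ℝ³ × ℂ`;
`g_{S²}` and `g_{S¹}` are the restrictions of the Euclidean inner products. -/
def warpedTensor (f : ℝ → ℝ) (p : M) (v w : E3 × ℂ) : ℝ :=
  inner ℝ v.1 w.1 + f (r p) ^ 2 * inner ℝ v.2 w.2

/-- A curve in `S² × S¹`, seen in `ℝ³ × ℂ`. -/
def ambient (c : ℝ → M) : ℝ → E3 × ℂ := fun t => (((c t).1 : E3), ((c t).2 : ℂ))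

/-- The velocity at time `t` of a curve defined on `[0, 1]`. -/
def velocity (c : ℝ → M) (t : ℝ) : E3 × ℂ := derivWithin (ambient c) (Icc 0 1) t

/-- The length `∫₀¹ √g(ċ, ċ) dt` with respect to `g = g_{S²} + f(r)² g_{S¹}`. -/
def length (f : ℝ → ℝ) (c : ℝ → M) : ℝ :=
  ∫ t in (0 : ℝ)..1, Real.sqrt (warpedTensor f (c t) (velocity c t) (velocity c t))

/-- `c` restricts to a continuously differentiable curve `[0, 1] → U` from `p` to `q`.
As `S² × S¹` is an embedded submanifold of `ℝ³ × ℂ`, differentiability may be tested there. -/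
structure IsCurve (U : Set M) (p q : M) (c : ℝ → M) : Prop where
  contDiffOn : ContDiffOn ℝ 1 (ambient c) (Icc 0 1)
  mem : ∀ t ∈ Icc (0 : ℝ) 1, c t ∈ U
  source : c 0 = p
  target : c 1 = q

/-- The Riemannian distance of the open subset `U` of `S² × S¹` with the metric
`g_{S²} + f(r)² g_{S¹}`: the infimum of the lengths of the continuously differentiable
curves that stay in `U`. -/
def riemannianDist (f : ℝ → ℝ) (U : Set M) (p q : M) : ℝ :=
  sInf {L : ℝ | ∃ c : ℝ → M, IsCurve U p q c ∧ length f c = L}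

/-- The distance `d₀` of the isometric product `g_{S²} + g_{S¹}`. -/
def d₀ : M → M → ℝ := riemannianDist (fun _ => 1) univ

/-- The warping function `ln ((1 + a) / (sin² r + a)) + β`. -/
def warp (β a ρ : ℝ) : ℝ := Real.log ((1 + a) / (Real.sin ρ ^ 2 + a)) + β

/-- The Riemannian distance of the warped product with warping function `warp β a`. -/
def dWarp (β a : ℝ) : M → M → ℝ := riemannianDist (warp β a) univ

/-- The extreme warping function `ln (1 / sin² r) + β`; it is used for `0 < r < π` only. -/
def warpLimit (β ρ : ℝ) : ℝ := Real.log (1 / Real.sin ρ ^ 2) + β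

/-- The Riemannian distance `d_{g_∞}` of the extreme limit `(S² × S¹ ∖ S, g_∞)`,
defined by curves that avoid `S`. -/
def dExtreme (β : ℝ) : (Sᶜ : Set M) → (Sᶜ : Set M) → ℝ :=
  fun p q => riemannianDist (warpLimit β) Sᶜ p q

end ExtremeLimit

end

/-!
The distances are studied by comparing curves with chords of `ℝ³ × ℂ` from below and with explicit
curves in the coordinates `(r, θ, φ)` from above.

*Lower bound.* A curve along which the warping function is at least `m` is at least as long as its
chord for the norm `√(|·|² + m² |·|²)`; as a curve that leaves a region has to travel a fixed
length first, local lower bounds for the warping function suffice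
(`min_chord_le_riemannianDist`). This makes all the distances definite.

*Upper bound.* In order to turn by `φ`, a curve may first move away from the poles by `η`, where all
the warping functions are at most `warpLimit β η`. The resulting bound (`HasPolarModulus`) does not
depend on `j`, so it passes to the supremum `dLim` of the increasing sequence `d_j`. It makes each
identity map from `S² × S¹` continuous, hence a homeomorphism by compactness; Dini's theorem turns
pointwise monotone convergence into uniform convergence, and this implies Gromov–Hausdorff
convergence.

*Completion.* With `l² = 1 / (1 + a)`, the map `r ↦ arccos (l cos r)` pulls the function
`warpLimit β` back to `warp β a` and is `1`-Lipschitz in `r`. Hence the part of a curve close to the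
singular set can be moved off it, with `θ` frozen, without becoming longer
(`exists_isCurve_push`); elsewhere the two warping functions are almost equal, and the correction of `θ` costs little near the poles. So
`dLim` and `dExtreme` agree off the singular set (`dLim_eq_dExtreme`), which has dense complement.

*Singular fibres.* The warping functions become arbitrarily large near the poles, so the lower bound
shows that `dLim` exceeds any multiple of the angle at small scales (`exists_mul_le_dLim`); the
one-dimensional measure and the length of the fibres are infinite. The growth is only logarithmic,
so that the choice of `η` proportional to the angle in the upper bound gives Hölder continuity with
any exponent less than one (`exists_holderOnWith_fibre`), and the dimension is one.

*Volume.* Near a level set of `r` off the poles, suitably scaled coordinates are bi-Lipschitz at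
small scales with constants close to one (`exists_chart_bilipschitz`). So the push-forward of the
three-dimensional Hausdorff measure under `r` has the density `(2π)² sin r · f_∞(r)`, the singular
set being null, and the total volume is the increment of a primitive.
-/

noncomputable section

namespace ExtremeLimit

/-! ### Curves and their lengths -/

/-- The speed `√g(ċ, ċ)` of a curve with respect to `g_{S²} + f(r)² g_{S¹}`. -/
def speed (f : ℝ → ℝ) (c : ℝ → M) (t : ℝ) : ℝ :=
  Real.sqrt (warpedTensor f (c t) (velocity c t) (velocity c t))

lemma length_eq_integral_speed (f : ℝ → ℝ) (c : ℝ → M) :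
    length f c = ∫ t in (0 : ℝ)..1, speed f c t := rfl

lemma warpedTensor_self (f : ℝ → ℝ) (p : M) (v : E3 × ℂ) :
    warpedTensor f p v v = ‖v.1‖ ^ 2 + f (r p) ^ 2 * ‖v.2‖ ^ 2 := by
  simp [warpedTensor]

lemma speed_nonneg (f : ℝ → ℝ) (c : ℝ → M) (t : ℝ) : 0 ≤ speed f c t := Real.sqrt_nonneg _

lemma length_nonneg (f : ℝ → ℝ) (c : ℝ → M) : 0 ≤ length f c :=
  intervalIntegral.integral_nonneg zero_le_one fun _ _ => Real.sqrt_nonneg _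

lemma isEmbedding_ambient : IsEmbedding fun p : M => ((p.1 : E3), (p.2 : ℂ)) :=
  IsEmbedding.prodMap IsEmbedding.subtypeVal
    (Isometry.isEmbedding (f := fun z : Circle => (z : ℂ)) fun _ _ => rfl)

lemma continuousOn_of_ambient {c : ℝ → M} {s : Set ℝ} (hc : ContinuousOn (ambient c) s) :
    ContinuousOn c s :=
  isEmbedding_ambient.isInducing.continuousOn_iff.2 hc

lemma continuous_r : Continuous r := by
  unfold r
  fun_prop

lemma hasDerivWithinAt_ambient {c : ℝ → M} (hc : ContDiffOn ℝ 1 (ambient c) (Icc 0 1)) {t : ℝ}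
    (ht : t ∈ Icc (0 : ℝ) 1) :
    HasDerivWithinAt (ambient c) (velocity c t) (Icc 0 1) t :=
  (hc.differentiableOn one_ne_zero t ht).hasDerivWithinAt

lemma continuousOn_velocity {c : ℝ → M} (hc : ContDiffOn ℝ 1 (ambient c) (Icc 0 1)) :
    ContinuousOn (velocity c) (Icc 0 1) :=
  hc.continuousOn_derivWithin (uniqueDiffOn_Icc zero_lt_one) le_rfl

lemma velocity_eq {c : ℝ → M} {t : ℝ} {v : E3 × ℂ} (ht : t ∈ Icc (0 : ℝ) 1)
    (h : HasDerivWithinAt (ambient c) v (Icc 0 1) t) : velocity c t = v :=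
  h.derivWithin (uniqueDiffOn_Icc zero_lt_one t ht)

lemma continuousOn_speed {f : ℝ → ℝ} {U : Set M} (hf : ContinuousOn (fun p => f (r p)) U)
    {c : ℝ → M} (hc : ContDiffOn ℝ 1 (ambient c) (Icc 0 1)) {s : Set ℝ} (hs : s ⊆ Icc 0 1)
    (hU : MapsTo c s U) : ContinuousOn (speed f c) s := by
  have h1 : ContinuousOn (fun t => f (r (c t))) s :=
    hf.comp ((continuousOn_of_ambient hc.continuousOn).mono hs) hU
  have h2 := (continuousOn_velocity hc).mono hs
  unfold speed
  simp only [warpedTensor_self]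
  exact ((h2.fst.norm.pow 2).add ((h1.pow 2).mul (h2.snd.norm.pow 2))).sqrt

/-- A curve along which the warping function is at least `m` is at least as long as the straight
segment between its end points for the Euclidean norm `√(|·|² + m² |·|²)` of `ℝ³ × ℂ`. -/
lemma chord_le_integral_speed {f : ℝ → ℝ} {U : Set M}
    (hf : ContinuousOn (fun p => f (r p)) U) {c : ℝ → M}
    (hc : ContDiffOn ℝ 1 (ambient c) (Icc 0 1)) {a b : ℝ} (ha : 0 ≤ a) (hab : a ≤ b) (hb : b ≤ 1)
    (hU : MapsTo c (Icc a b) U) {m : ℝ} (hm : 0 ≤ m) (hfm : ∀ t ∈ Icc a b, m ≤ f (r (c t))) :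
    Real.sqrt (‖((c b).1 : E3) - (c a).1‖ ^ 2 + m ^ 2 * ‖((c b).2 : ℂ) - (c a).2‖ ^ 2) ≤
      ∫ t in a..b, speed f c t := by
  have hsub : Icc a b ⊆ Icc 0 1 := Icc_subset_Icc ha hb
  -- `Φ` turns the weighted norm into the norm of an inner product space
  let Φ : E3 × ℂ →L[ℝ] WithLp 2 (E3 × ℂ) :=
    ((WithLp.prodContinuousLinearEquiv 2 ℝ E3 ℂ).symm : E3 × ℂ →L[ℝ] WithLp 2 (E3 × ℂ)).comp
      ((ContinuousLinearMap.fst ℝ E3 ℂ).prod (m • ContinuousLinearMap.snd ℝ E3 ℂ))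
  have hΦ : ∀ v : E3 × ℂ, ‖Φ v‖ = Real.sqrt (‖v.1‖ ^ 2 + m ^ 2 * ‖v.2‖ ^ 2) := by
    intro v
    rw [WithLp.prod_norm_eq_of_L2]
    have h1 : (Φ v).fst = v.1 := rfl
    have h2 : (Φ v).snd = m • v.2 := rfl
    rw [h1, h2, norm_smul, mul_pow, Real.norm_eq_abs, sq_abs]
  have hcv : ContinuousOn (fun t => Φ (velocity c t)) (Icc a b) :=
    Φ.continuous.comp_continuousOn ((continuousOn_velocity hc).mono hsub)
  have hint : ∫ t in a..b, Φ (velocity c t) = Φ (ambient c b) - Φ (ambient c a) := by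
    refine intervalIntegral.integral_eq_sub_of_hasDerivAt_of_le
      (f := fun t => Φ (ambient c t)) hab ?_ ?_ ?_
    · exact Φ.continuous.comp_continuousOn (hc.continuousOn.mono hsub)
    · intro t ht
      have ht' : t ∈ Icc (0 : ℝ) 1 := hsub (Ioo_subset_Icc_self ht)
      exact Φ.hasFDerivAt.comp_hasDerivAt t ((hasDerivWithinAt_ambient hc ht').hasDerivAt
        (Icc_mem_nhds (ha.trans_lt ht.1) (ht.2.trans_le hb)))
    · exact hcv.intervalIntegrable_of_Icc hab
  have h1 : ‖Φ (ambient c b) - Φ (ambient c a)‖ = Real.sqrt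
      (‖((c b).1 : E3) - (c a).1‖ ^ 2 + m ^ 2 * ‖((c b).2 : ℂ) - (c a).2‖ ^ 2) := by
    rw [← map_sub, hΦ]; rfl
  rw [← h1, ← hint]
  refine (intervalIntegral.norm_integral_le_integral_norm hab).trans ?_
  refine intervalIntegral.integral_mono_on hab
    (hcv.norm.intervalIntegrable_of_Icc hab)
    ((continuousOn_speed hf hc hsub hU).intervalIntegrable_of_Icc hab) fun t ht => ?_
  rw [hΦ, speed, warpedTensor_self]
  have := hfm t ht
  gcongr

/-! ### Reparametrization and concatenation -/

section reparam

variable {c : ℝ → M} {φ : ℝ → ℝ}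

lemma contDiffOn_comp (hc : ContDiffOn ℝ 1 (ambient c) (Icc 0 1)) (hφ : ContDiff ℝ 1 φ) {s : Set ℝ}
    (hmap : MapsTo φ s (Icc 0 1)) : ContDiffOn ℝ 1 (ambient (c ∘ φ)) s :=
  hc.comp hφ.contDiffOn hmap

lemma speed_comp (f : ℝ → ℝ) (hc : ContDiffOn ℝ 1 (ambient c) (Icc 0 1)) (hφ : ContDiff ℝ 1 φ)
    (hmap : MapsTo φ (Icc 0 1) (Icc 0 1)) {t : ℝ} (ht : t ∈ Icc (0 : ℝ) 1) :
    speed f (c ∘ φ) t = |deriv φ t| * speed f c (φ t) := by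
  have h : velocity (c ∘ φ) t = deriv φ t • velocity c (φ t) :=
    velocity_eq ht ((hasDerivWithinAt_ambient hc (hmap ht)).scomp t
      (hφ.differentiable one_ne_zero t).hasDerivAt.hasDerivWithinAt hmap)
  rw [speed, speed, warpedTensor_self, warpedTensor_self, h, ← Real.sqrt_sq_eq_abs,
    ← Real.sqrt_mul (sq_nonneg _)]
  simp only [Prod.smul_fst, Prod.smul_snd, norm_smul, mul_pow, Real.norm_eq_abs, sq_abs,
    Function.comp_apply]
  ring_nf

lemma integral_speed_comp (f : ℝ → ℝ) (hc : ContDiffOn ℝ 1 (ambient c) (Icc 0 1))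
    (hφ : ContDiff ℝ 1 φ) (hmap : MapsTo φ (Icc 0 1) (Icc 0 1)) (hmono : Monotone φ) {a b : ℝ}
    (ha : 0 ≤ a) (hab : a ≤ b) (hb : b ≤ 1) :
    ∫ t in a..b, speed f (c ∘ φ) t = ∫ t in φ a..φ b, speed f c t := by
  have hd : ∀ t, 0 ≤ deriv φ t := fun t => hmono.deriv_nonneg
  rw [← intervalIntegral.integral_comp_mul_deriv_of_deriv_nonneg (f' := deriv φ)
    hφ.continuous.continuousOn
    (fun t _ => (hφ.differentiable one_ne_zero t).hasDerivAt) fun t _ => hd t]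
  refine intervalIntegral.integral_congr fun t ht => ?_
  rw [uIcc_of_le hab] at ht
  rw [speed_comp f hc hφ hmap (Icc_subset_Icc ha hb ht), abs_of_nonneg (hd t), mul_comm]
  rfl

/-- The part of a `C¹` curve between the times `a ≤ b` is a curve with the length
`∫ₐᵇ √g(ċ, ċ)`, provided that it stays in `V`. -/
lemma exists_isCurve_restrict (f : ℝ → ℝ) (hc : ContDiffOn ℝ 1 (ambient c) (Icc 0 1)) {a b : ℝ}
    (ha : 0 ≤ a) (hab : a ≤ b) (hb : b ≤ 1) {V : Set M} (hV : MapsTo c (Icc a b) V) :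
    ∃ c', IsCurve V (c a) (c b) c' ∧ length f c' = ∫ t in a..b, speed f c t := by
  let φ : ℝ → ℝ := fun t => a + t * (b - a)
  have hφ : ContDiff ℝ 1 φ := by fun_prop
  have hm : MapsTo φ (Icc 0 1) (Icc a b) := fun t ht =>
    ⟨by simp only [φ]; nlinarith [ht.1, ht.2], by simp only [φ]; nlinarith [ht.1, ht.2]⟩
  have hm' : MapsTo φ (Icc 0 1) (Icc 0 1) := fun t ht => Icc_subset_Icc ha hb (hm ht)
  have hmono : Monotone φ := fun s t hst => by simp only [φ]; nlinarith
  refine ⟨c ∘ φ, ⟨contDiffOn_comp hc hφ hm', fun t ht => hV (hm ht), by simp [φ], by simp [φ]⟩, ?_⟩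
  rw [length_eq_integral_speed, integral_speed_comp f hc hφ hm' hmono le_rfl zero_le_one le_rfl]
  simp [φ]

end reparam

lemma IsCurve.reverse {U : Set M} {p q : M} {c : ℝ → M} (hc : IsCurve U p q c) (f : ℝ → ℝ) :
    ∃ c', IsCurve U q p c' ∧ length f c' = length f c := by
  have hφ : ContDiff ℝ 1 fun t : ℝ => 1 - t := by fun_prop
  have hm : MapsTo (fun t : ℝ => 1 - t) (Icc 0 1) (Icc 0 1) := fun t ht =>
    ⟨by linarith [ht.2], by linarith [ht.1]⟩
  refine ⟨c ∘ fun t => 1 - t, ⟨contDiffOn_comp hc.1 hφ hm, fun t ht => hc.mem _ (hm ht),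
    by simp [hc.target], by simp [hc.source]⟩, ?_⟩
  have : ∀ t ∈ Icc (0 : ℝ) 1, speed f (c ∘ fun t => 1 - t) t = speed f c (1 - t) := by
    intro t ht
    rw [speed_comp f hc.1 hφ hm ht]
    simp
  rw [length_eq_integral_speed, length_eq_integral_speed, intervalIntegral.integral_congr
    (g := fun t => speed f c (1 - t)) (by rwa [uIcc_of_le zero_le_one]),
    intervalIntegral.integral_comp_sub_left]
  simp

/-- Curves can be concatenated: slowing them down to velocity zero at their end points makes the
concatenation continuously differentiable. -/
lemma IsCurve.trans {U : Set M} {p q s : M} {c₁ c₂ : ℝ → M} {f : ℝ → ℝ}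
    (hf : ContinuousOn (fun p => f (r p)) U) (h₁ : IsCurve U p q c₁)
    (h₂ : IsCurve U q s c₂) :
    ∃ c, IsCurve U p s c ∧ length f c = length f c₁ + length f c₂ := by
  let σ := Real.smoothTransition
  let φ₁ : ℝ → ℝ := fun t => σ (2 * t)
  let φ₂ : ℝ → ℝ := fun t => σ (2 * t - 1)
  have hσ : ContDiff ℝ 1 σ := Real.smoothTransition.contDiff (n := 1)
  have hφ₁ : ContDiff ℝ 1 φ₁ := hσ.comp (by fun_prop)
  have hφ₂ : ContDiff ℝ 1 φ₂ := hσ.comp (by fun_prop)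
  have hσm : ∀ x, σ x ∈ Icc (0 : ℝ) 1 := fun x =>
    ⟨Real.smoothTransition.nonneg x, Real.smoothTransition.le_one x⟩
  have hm₁ : ∀ s, MapsTo φ₁ s (Icc 0 1) := fun _ _ _ => hσm _
  have hm₂ : ∀ s, MapsTo φ₂ s (Icc 0 1) := fun _ _ _ => hσm _
  have hmono₁ : Monotone φ₁ := fun x y hxy => Real.smoothTransition.monotone (by linarith)
  have hmono₂ : Monotone φ₂ := fun x y hxy => Real.smoothTransition.monotone (by linarith)
  have e₁ : ∀ t, 1 / 2 ≤ t → φ₁ t = 1 := fun t ht =>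
    Real.smoothTransition.one_of_one_le (by linarith)
  have e₂ : ∀ t, t ≤ 1 / 2 → φ₂ t = 0 := fun t ht =>
    Real.smoothTransition.zero_of_nonpos (by linarith)
  let c : ℝ → M := fun t => if t ≤ 1 / 2 then c₁ (φ₁ t) else c₂ (φ₂ t)
  have c_left : ∀ t, t ≤ 1 / 2 → c t = (c₁ ∘ φ₁) t := fun t ht => if_pos ht
  have c_right : ∀ t, 1 / 2 ≤ t → c t = (c₂ ∘ φ₂) t := by
    intro t ht
    rcases ht.eq_or_lt with rfl | h
    · rw [c_left _ le_rfl, Function.comp, Function.comp, e₁ _ le_rfl, e₂ _ le_rfl, h₁.target,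
        h₂.source]
    · exact if_neg (not_le.2 h)
  -- the concatenation is a sum of two functions that are smooth on the whole line
  have hsum : ambient c = fun t => ambient (c₁ ∘ φ₁) t + ambient (c₂ ∘ φ₂) t -
      (((q.1 : E3)), (q.2 : ℂ)) := by
    funext t
    rcases le_total t (1 / 2) with h | h
    · have : ambient (c₂ ∘ φ₂) t = ((q.1 : E3), (q.2 : ℂ)) := by
        simp [ambient, e₂ t h, h₂.source]
      rw [this, add_sub_cancel_right, ambient, ambient, c_left t h]
    · have : ambient (c₁ ∘ φ₁) t = ((q.1 : E3), (q.2 : ℂ)) := by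
        simp [ambient, e₁ t h, h₁.target]
      rw [this, add_sub_cancel_left, ambient, ambient, c_right t h]
  have hc : ContDiffOn ℝ 1 (ambient c) (Icc 0 1) := by
    rw [hsum]
    exact ((contDiffOn_comp h₁.1 hφ₁ (hm₁ _)).add (contDiffOn_comp h₂.1 hφ₂ (hm₂ _))).sub
      contDiffOn_const
  have hcurve : IsCurve U p s c := by
    refine ⟨hc, fun t ht => ?_, ?_, ?_⟩
    · rcases le_total t (1 / 2) with h | h
      · rw [c_left t h]; exact h₁.mem _ (hσm _)
      · rw [c_right t h]; exact h₂.mem _ (hσm _)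
    · rw [c_left 0 (by norm_num), Function.comp]
      simp [φ₁, σ, Real.smoothTransition.zero, h₁.source]
    · rw [c_right 1 (by norm_num), Function.comp]
      have : φ₂ 1 = 1 := by
        show σ (2 * 1 - 1) = 1
        norm_num [σ, Real.smoothTransition.one]
      rw [this, h₂.target]
  refine ⟨c, hcurve, ?_⟩
  have hcont := continuousOn_speed hf hc subset_rfl hcurve.mem
  have hi : ∀ a b : ℝ, 0 ≤ a → a ≤ b → b ≤ 1 → IntervalIntegrable (speed f c) volume a b :=
    fun a b ha hab hb => (hcont.mono (Icc_subset_Icc ha hb)).intervalIntegrable_of_Icc hab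
  rw [length_eq_integral_speed, ← intervalIntegral.integral_add_adjacent_intervals
    (hi 0 (1 / 2) (by norm_num) (by norm_num) (by norm_num))
    (hi (1 / 2) 1 (by norm_num) (by norm_num) (by norm_num))]
  have hspeed : ∀ {c' : ℝ → M} {t : ℝ}, c =ᶠ[𝓝 t] c' → speed f c t = speed f c' t := by
    intro c' t h
    have h1 : ambient c =ᶠ[𝓝[Icc 0 1] t] ambient c' :=
      (h.mono fun x hx => by simp [ambient, hx]).filter_mono nhdsWithin_le_nhds
    have h2 : velocity c t = velocity c' t :=
      h1.derivWithin_eq (by simp [ambient, h.eq_of_nhds])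
    rw [speed, speed, h2, h.eq_of_nhds]
  congr 1
  · have : ∫ t in (0 : ℝ)..(1 / 2), speed f c t = ∫ t in (0 : ℝ)..(1 / 2), speed f (c₁ ∘ φ₁) t := by
      refine intervalIntegral.integral_congr_Ioo_of_le (by norm_num) fun t ht => hspeed ?_
      filter_upwards [Iio_mem_nhds ht.2] with x hx using c_left x (le_of_lt hx)
    rw [this, integral_speed_comp f h₁.1 hφ₁ (hm₁ _) hmono₁ le_rfl (by norm_num) (by norm_num),
      e₁ _ le_rfl]
    simp [φ₁, σ, Real.smoothTransition.zero, length_eq_integral_speed]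
  · have : ∫ t in (1 / 2 : ℝ)..1, speed f c t = ∫ t in (1 / 2 : ℝ)..1, speed f (c₂ ∘ φ₂) t := by
      refine intervalIntegral.integral_congr_Ioo_of_le (by norm_num) fun t ht => hspeed ?_
      filter_upwards [Ioi_mem_nhds ht.1] with x hx using c_right x (le_of_lt hx)
    rw [this, integral_speed_comp f h₂.1 hφ₂ (hm₂ _) hmono₂ (by norm_num) (by norm_num) le_rfl,
      e₂ _ le_rfl]
    have : φ₂ 1 = 1 := by
      show σ (2 * 1 - 1) = 1
      norm_num [σ, Real.smoothTransition.one]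
    rw [this, length_eq_integral_speed]

/-! ### Riemannian distances -/

section riemannianDist

variable {f : ℝ → ℝ} {U : Set M} {p q s : M} {c : ℝ → M}

lemma riemannianDist_nonneg : 0 ≤ riemannianDist f U p q :=
  Real.sInf_nonneg fun _ ⟨c, _, h⟩ => h ▸ length_nonneg f c

lemma IsCurve.riemannianDist_le (hc : IsCurve U p q c) : riemannianDist f U p q ≤ length f c :=
  csInf_le ⟨0, fun _ ⟨c, _, h⟩ => h ▸ length_nonneg f c⟩ ⟨c, hc, rfl⟩

lemma le_riemannianDist (hne : ∃ c, IsCurve U p q c) {L : ℝ}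
    (h : ∀ c, IsCurve U p q c → L ≤ length f c) : L ≤ riemannianDist f U p q := by
  obtain ⟨c, hc⟩ := hne
  exact le_csInf ⟨_, c, hc, rfl⟩ fun _ ⟨c', hc', h'⟩ => h' ▸ h c' hc'

lemma exists_isCurve_length_lt (hne : ∃ c, IsCurve U p q c) {L : ℝ}
    (h : riemannianDist f U p q < L) : ∃ c, IsCurve U p q c ∧ length f c < L := by
  obtain ⟨c, hc⟩ := hne
  have hne : {L : ℝ | ∃ c, IsCurve U p q c ∧ length f c = L}.Nonempty := ⟨_, c, hc, rfl⟩
  obtain ⟨_, ⟨c', hc', rfl⟩, h'⟩ := exists_lt_of_csInf_lt hne h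
  exact ⟨c', hc', h'⟩

lemma riemannianDist_self (hp : p ∈ U) : riemannianDist f U p p = 0 := by
  have hc : IsCurve U p p fun _ => p := ⟨contDiffOn_const, fun _ _ => hp, rfl, rfl⟩
  refine le_antisymm (hc.riemannianDist_le.trans ?_) riemannianDist_nonneg
  have : ∀ t, velocity (fun _ => p) t = 0 := fun t => by
    unfold velocity ambient
    simp
  simp [length, this, warpedTensor]

lemma riemannianDist_comm : riemannianDist f U p q = riemannianDist f U q p := by
  unfold riemannianDist
  congr 1
  ext L
  constructor <;> rintro ⟨c, hc, rfl⟩ <;> exact hc.reverse f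

lemma riemannianDist_triangle (hf : ContinuousOn (fun p => f (r p)) U)
    (h₁ : ∃ c, IsCurve U p q c) (h₂ : ∃ c, IsCurve U q s c) :
    riemannianDist f U p s ≤ riemannianDist f U p q + riemannianDist f U q s := by
  refine le_of_forall_pos_lt_add fun ε hε => ?_
  obtain ⟨c₁, hc₁, hl₁⟩ := exists_isCurve_length_lt (f := f) h₁
    (lt_add_of_pos_right _ (half_pos hε))
  obtain ⟨c₂, hc₂, hl₂⟩ := exists_isCurve_length_lt (f := f) h₂
    (lt_add_of_pos_right _ (half_pos hε))
  obtain ⟨c, hc, hl⟩ := hc₁.trans hf hc₂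
  have := hc.riemannianDist_le (f := f)
  linarith

/-- If the warping function is at least `m` where the height `cos r` differs by less than `η` from
its value at `p`, then a curve starting at `p` either is as long as a chord weighted with `m`, or
has to travel at least `η` in order to leave that region. -/
lemma min_chord_le_riemannianDist (hf : ContinuousOn (fun p => f (r p)) U)
    (hf0 : ∀ x ∈ U, 0 ≤ f (r x)) (hne : ∃ c, IsCurve U p q c) {m η : ℝ} (hm : 0 ≤ m)
    (hfm : ∀ x ∈ U, |(x.1 : E3) 2 - (p.1 : E3) 2| < η → m ≤ f (r x)) :
    min (Real.sqrt (‖(q.1 : E3) - p.1‖ ^ 2 + m ^ 2 * ‖(q.2 : ℂ) - p.2‖ ^ 2)) η ≤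
      riemannianDist f U p q := by
  refine le_riemannianDist hne fun c hc => ?_
  by_cases hstay : ∀ t ∈ Icc (0 : ℝ) 1, |((c t).1 : E3) 2 - (p.1 : E3) 2| < η
  · refine (min_le_left _ _).trans ?_
    have := chord_le_integral_speed hf hc.1 le_rfl zero_le_one le_rfl hc.mem hm
      fun t ht => hfm _ (hc.mem t ht) (hstay t ht)
    rwa [hc.source, hc.target] at this
  · push Not at hstay
    obtain ⟨t, ht, hη⟩ := hstay
    refine (min_le_right _ _).trans (hη.trans ?_)
    have hmem : MapsTo c (Icc 0 t) U := fun x hx => hc.mem x ⟨hx.1, hx.2.trans ht.2⟩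
    have h := chord_le_integral_speed hf hc.1 le_rfl ht.1 ht.2 hmem le_rfl
      fun x hx => hf0 _ (hmem hx)
    rw [hc.source] at h
    have h2 : |((c t).1 : E3) 2 - (p.1 : E3) 2| ≤ ‖((c t).1 : E3) - p.1‖ := by
      rw [← PiLp.sub_apply, ← Real.norm_eq_abs]
      exact PiLp.norm_apply_le _ 2
    have h3 : ‖((c t).1 : E3) - p.1‖ ≤ ∫ x in (0 : ℝ)..t, speed f c x := by
      simpa using h
    have hcont := continuousOn_speed hf hc.1 subset_rfl hc.mem
    have h4 : ∫ x in (0 : ℝ)..t, speed f c x ≤ length f c :=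
      intervalIntegral.integral_mono_interval le_rfl ht.1 ht.2
        (Eventually.of_forall fun x => speed_nonneg f c x)
        (hcont.intervalIntegrable_of_Icc zero_le_one)
    linarith

end riemannianDist

/-! ### The coordinates `(r, θ, φ)` -/

lemma point_height (ρ θ φ : ℝ) : ((point ρ θ φ).1 : E3) 2 = Real.cos ρ := rfl

lemma r_point_of_mem {ρ : ℝ} (h : ρ ∈ Icc 0 Real.pi) (θ φ : ℝ) : r (point ρ θ φ) = ρ :=
  Real.arccos_cos h.1 h.2

lemma sum_sq_sphere (x : Metric.sphere (0 : E3) 1) :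
    (x : E3) 0 ^ 2 + (x : E3) 1 ^ 2 + (x : E3) 2 ^ 2 = 1 := by
  have h : ‖(x : E3)‖ ^ 2 = 1 := by simp
  rw [EuclideanSpace.norm_sq_eq, Fin.sum_univ_three] at h
  simpa using h

lemma height_sq_le (x : Metric.sphere (0 : E3) 1) : (x : E3) 2 ^ 2 ≤ 1 := by
  nlinarith [sum_sq_sphere x, sq_nonneg ((x : E3) 0), sq_nonneg ((x : E3) 1)]

lemma height_mem (x : Metric.sphere (0 : E3) 1) : (x : E3) 2 ∈ Icc (-1 : ℝ) 1 :=
  abs_le.1 (abs_le_one_iff_mul_self_le_one.2 (by nlinarith [height_sq_le x]))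

lemma cos_r (p : M) : Real.cos (r p) = (p.1 : E3) 2 :=
  Real.cos_arccos (height_mem p.1).1 (height_mem p.1).2

lemma sin_r_sq (p : M) : Real.sin (r p) ^ 2 = 1 - (p.1 : E3) 2 ^ 2 := by
  rw [Real.sin_sq, cos_r]

lemma r_mem (p : M) : r p ∈ Icc 0 Real.pi := ⟨Real.arccos_nonneg _, Real.arccos_le_pi _⟩

lemma mem_compl_S {p : M} : p ∈ Sᶜ ↔ (p.1 : E3) 2 ^ 2 < 1 := by
  simp only [S, fibre, mem_compl_iff, mem_union, mem_ofPred_eq, r, Real.arccos_eq_zero,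
    Real.arccos_eq_pi, not_or, not_le, sq_lt_one_iff_abs_lt_one, abs_lt]
  tauto

lemma exists_angle (z : Circle) : ∃ φ ∈ Ico 0 (2 * Real.pi), Circle.exp φ = z := by
  have h1 := Complex.neg_pi_lt_arg (z : ℂ)
  have h2 := Complex.arg_le_pi (z : ℂ)
  have hpi := Real.pi_pos
  rcases le_or_gt 0 (Complex.arg z) with h | h
  · exact ⟨_, ⟨h, by linarith⟩, Circle.exp_arg z⟩
  · exact ⟨Complex.arg z + 2 * Real.pi, ⟨by linarith, by linarith⟩, by
      rw [Circle.exp_add, Circle.exp_two_pi, mul_one, Circle.exp_arg]⟩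

lemma exists_polar (p : M) :
    ∃ θ ∈ Ico 0 (2 * Real.pi), ∃ φ ∈ Ico 0 (2 * Real.pi), p = point (r p) θ φ := by
  obtain ⟨φ, hφ, hφ'⟩ := exists_angle p.2
  have hs := sin_r_sq p
  have hsum := sum_sq_sphere p.1
  suffices h : ∃ θ ∈ Ico 0 (2 * Real.pi), (p.1 : E3) 0 = Real.sin (r p) * Real.cos θ ∧
      (p.1 : E3) 1 = Real.sin (r p) * Real.sin θ by
    obtain ⟨θ, hθ, h0, h1⟩ := h
    refine ⟨θ, hθ, φ, hφ, Prod.ext (Subtype.ext ?_) hφ'.symm⟩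
    ext i
    fin_cases i
    · exact h0
    · exact h1
    · exact (cos_r p).symm
  by_cases h : Real.sin (r p) = 0
  · rw [h] at hs ⊢
    refine ⟨0, ⟨le_rfl, by positivity⟩, ?_, ?_⟩
    · nlinarith [sq_nonneg ((p.1 : E3) 0), sq_nonneg ((p.1 : E3) 1)]
    · nlinarith [sq_nonneg ((p.1 : E3) 0), sq_nonneg ((p.1 : E3) 1)]
  · let w : ℂ := ⟨(p.1 : E3) 0 / Real.sin (r p), (p.1 : E3) 1 / Real.sin (r p)⟩
    have hw : ‖w‖ = 1 := by
      rw [Complex.norm_eq_sqrt_sq_add_sq, Real.sqrt_eq_one]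
      simp only [w]
      field_simp
      linarith
    obtain ⟨θ, hθ, hθ'⟩ := exists_angle ⟨w, by simpa [Submonoid.unitSphere] using hw⟩
    refine ⟨θ, hθ, ?_, ?_⟩
    · have := congrArg (fun z : Circle => (z : ℂ).re) hθ'
      simp only [Circle.coe_exp, Complex.exp_ofReal_mul_I_re, w] at this
      rw [this]; field_simp
    · have := congrArg (fun z : Circle => (z : ℂ).im) hθ'
      simp only [Circle.coe_exp, Complex.exp_ofReal_mul_I_im, w] at this
      rw [this]; field_simp

lemma point_mem_compl_S {ρ : ℝ} (θ φ : ℝ) (h : Real.sin ρ ≠ 0) : point ρ θ φ ∈ Sᶜ := by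
  rw [mem_compl_S, point_height]
  have : 0 < Real.sin ρ ^ 2 := by positivity
  nlinarith [Real.sin_sq_add_cos_sq ρ]

lemma chord_sphere_sq (ρ θ φ ρ' θ' φ' : ℝ) :
    ‖((point ρ θ φ).1 : E3) - (point ρ' θ' φ').1‖ ^ 2 =
      (2 - 2 * Real.cos (ρ - ρ')) +
        Real.sin ρ * Real.sin ρ' * (2 - 2 * Real.cos (θ - θ')) := by
  rw [EuclideanSpace.norm_sq_eq, Fin.sum_univ_three]
  simp only [point, PiLp.sub_apply, Matrix.cons_val, Real.norm_eq_abs, sq_abs]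
  rw [Real.cos_sub, Real.cos_sub]
  linear_combination Real.sin ρ ^ 2 * Real.sin_sq_add_cos_sq θ +
    Real.sin ρ' ^ 2 * Real.sin_sq_add_cos_sq θ' + Real.sin_sq_add_cos_sq ρ +
    Real.sin_sq_add_cos_sq ρ'

lemma chord_circle_sq (ρ θ φ ρ' θ' φ' : ℝ) :
    ‖((point ρ θ φ).2 : ℂ) - (point ρ' θ' φ').2‖ ^ 2 = 2 - 2 * Real.cos (φ - φ') := by
  rw [← Complex.normSq_eq_norm_sq, Complex.normSq_apply]
  simp only [point, Circle.coe_exp, Complex.sub_re, Complex.sub_im, Complex.exp_ofReal_mul_I_re,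
    Complex.exp_ofReal_mul_I_im]
  rw [Real.cos_sub]
  linear_combination Real.sin_sq_add_cos_sq φ + Real.sin_sq_add_cos_sq φ'

lemma continuous_point : Continuous fun x : ℝ × ℝ × ℝ => point x.1 x.2.1 x.2.2 := by
  unfold point
  refine Continuous.prodMk (Continuous.subtype_mk ?_ _) (by fun_prop)
  refine (PiLp.continuous_toLp 2 _).comp (continuous_pi fun i => ?_)
  fin_cases i <;> simp <;> fun_prop

/-- The velocity of the sphere component of a curve in the coordinates `(r, θ)`. -/
lemma hasDerivWithinAt_sphere {R Θ : ℝ → ℝ} {R' Θ' t : ℝ} {s : Set ℝ} (φ : ℝ)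
    (hR : HasDerivWithinAt R R' s t) (hΘ : HasDerivWithinAt Θ Θ' s t) :
    ∃ v : E3, HasDerivWithinAt (fun x => ((point (R x) (Θ x) φ).1 : E3)) v s t ∧
      ‖v‖ ^ 2 = R' ^ 2 + Real.sin (R t) ^ 2 * Θ' ^ 2 := by
  refine ⟨!₂[Real.cos (R t) * R' * Real.cos (Θ t) + Real.sin (R t) * (-Real.sin (Θ t) * Θ'),
    Real.cos (R t) * R' * Real.sin (Θ t) + Real.sin (R t) * (Real.cos (Θ t) * Θ'),
    -Real.sin (R t) * R'], ?_, ?_⟩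
  · have : HasDerivWithinAt (fun x => ![Real.sin (R x) * Real.cos (Θ x),
        Real.sin (R x) * Real.sin (Θ x), Real.cos (R x)])
        ![Real.cos (R t) * R' * Real.cos (Θ t) + Real.sin (R t) * (-Real.sin (Θ t) * Θ'),
        Real.cos (R t) * R' * Real.sin (Θ t) + Real.sin (R t) * (Real.cos (Θ t) * Θ'),
        -Real.sin (R t) * R'] s t := by
      rw [hasDerivWithinAt_pi]
      intro i
      fin_cases i
      · exact hR.sin.mul hΘ.cos
      · exact hR.sin.mul hΘ.sin
      · exact hR.cos
    exact (PiLp.continuousLinearEquiv 2 ℝ fun _ : Fin 3 => ℝ).symm.hasFDerivAt.comp_hasDerivWithinAt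
      t this
  · rw [EuclideanSpace.norm_sq_eq, Fin.sum_univ_three]
    simp only [Matrix.cons_val, Real.norm_eq_abs, sq_abs]
    linear_combination (Real.cos (R t) ^ 2 * R' ^ 2 + Real.sin (R t) ^ 2 * Θ' ^ 2) *
      Real.sin_sq_add_cos_sq (Θ t) + R' ^ 2 * Real.sin_sq_add_cos_sq (R t)

lemma contDiffOn_sphere {R Θ : ℝ → ℝ} {s : Set ℝ} (φ : ℝ) (hR : ContDiffOn ℝ 1 R s)
    (hΘ : ContDiffOn ℝ 1 Θ s) :
    ContDiffOn ℝ 1 (fun x => ((point (R x) (Θ x) φ).1 : E3)) s := by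
  rw [contDiffOn_euclidean]
  intro i
  fin_cases i
  · exact hR.sin.mul hΘ.cos
  · exact hR.sin.mul hΘ.sin
  · exact hR.cos

section segment

variable {U : Set M} {ρ₀ ρ₁ θ₀ θ₁ φ₀ φ₁ : ℝ}

/-- The curve that is a straight segment in the coordinates `(r, θ, φ)`. -/
def coordSegment (ρ₀ ρ₁ θ₀ θ₁ φ₀ φ₁ : ℝ) (t : ℝ) : M :=
  point (ρ₀ + t * (ρ₁ - ρ₀)) (θ₀ + t * (θ₁ - θ₀)) (φ₀ + t * (φ₁ - φ₀))

lemma isCurve_coordSegment (hU : ∀ ρ ∈ uIcc ρ₀ ρ₁, ∀ θ φ, point ρ θ φ ∈ U) :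
    IsCurve U (point ρ₀ θ₀ φ₀) (point ρ₁ θ₁ φ₁) (coordSegment ρ₀ ρ₁ θ₀ θ₁ φ₀ φ₁) := by
  refine ⟨?_, fun t ht => hU _ ?_ _ _, by simp [coordSegment], by simp [coordSegment]⟩
  · refine ContDiffOn.prodMk (contDiffOn_sphere 0 (by fun_prop) (by fun_prop)) ?_
    show ContDiffOn ℝ 1 (fun t : ℝ => ((Circle.exp (φ₀ + t * (φ₁ - φ₀)) : Circle) : ℂ)) (Icc 0 1)
    simp only [Circle.coe_exp]
    have : ContDiff ℝ 1 fun t : ℝ => ((φ₀ + t * (φ₁ - φ₀) : ℝ) : ℂ) :=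
      Complex.ofRealCLM.contDiff.comp (contDiff_const.add (contDiff_id.mul contDiff_const))
    exact (this.mul contDiff_const).cexp.contDiffOn
  · have := (convex_uIcc ρ₀ ρ₁).add_smul_sub_mem left_mem_uIcc right_mem_uIcc ht
    simpa using this

/-- The Riemannian distance is bounded by the length of a segment in the coordinates `(r, θ, φ)`. -/
lemma riemannianDist_point_le {f : ℝ → ℝ} (hU : ∀ ρ ∈ uIcc ρ₀ ρ₁, ∀ θ φ, point ρ θ φ ∈ U)
    {B C : ℝ} (hB : ∀ ρ ∈ uIcc ρ₀ ρ₁, |Real.sin ρ * (θ₁ - θ₀)| ≤ B)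
    (hC : ∀ ρ ∈ uIcc ρ₀ ρ₁, |f (Real.arccos (Real.cos ρ)) * (φ₁ - φ₀)| ≤ C) :
    riemannianDist f U (point ρ₀ θ₀ φ₀) (point ρ₁ θ₁ φ₁) ≤
      Real.sqrt ((ρ₁ - ρ₀) ^ 2 + B ^ 2 + C ^ 2) := by
  refine (isCurve_coordSegment hU).riemannianDist_le.trans ((le_abs_self _).trans ?_)
  rw [length_eq_integral_speed, ← Real.norm_eq_abs]
  refine (intervalIntegral.norm_integral_le_of_norm_le_const (C := _) fun t ht => ?_).trans_eq
    (by rw [sub_zero, abs_one, mul_one])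
  rw [uIoc_of_le zero_le_one] at ht
  have ht : t ∈ Icc (0 : ℝ) 1 := Ioc_subset_Icc_self ht
  have hmem : ρ₀ + t * (ρ₁ - ρ₀) ∈ uIcc ρ₀ ρ₁ := by
    simpa using (convex_uIcc ρ₀ ρ₁).add_smul_sub_mem left_mem_uIcc right_mem_uIcc ht
  have hlin : ∀ x₀ x₁ : ℝ, HasDerivAt (fun t => x₀ + t * (x₁ - x₀)) (x₁ - x₀) t := fun x₀ x₁ => by
    simpa using ((hasDerivAt_id t).mul_const (x₁ - x₀)).const_add x₀
  obtain ⟨v, hv, hvn⟩ := hasDerivWithinAt_sphere 0 (hlin ρ₀ ρ₁).hasDerivWithinAt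
    (hlin θ₀ θ₁).hasDerivWithinAt (s := Icc 0 1)
  have hw : HasDerivWithinAt (fun t : ℝ => ((Circle.exp (φ₀ + t * (φ₁ - φ₀)) : Circle) : ℂ))
      (Complex.exp ((φ₀ + t * (φ₁ - φ₀) : ℝ) * Complex.I) * ((φ₁ - φ₀ : ℝ) * Complex.I))
      (Icc 0 1) t := by
    simp only [Circle.coe_exp]
    exact (((hlin φ₀ φ₁).ofReal_comp.mul_const Complex.I).cexp).hasDerivWithinAt
  have hvel : velocity (coordSegment ρ₀ ρ₁ θ₀ θ₁ φ₀ φ₁) t = (v, _) :=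
    velocity_eq ht (hv.prodMk hw)
  rw [Real.norm_of_nonneg (speed_nonneg _ _ _), speed, warpedTensor_self, hvel]
  refine Real.sqrt_le_sqrt ?_
  simp only [hvn, norm_mul, Complex.norm_exp_ofReal_mul_I, Complex.norm_I, mul_one, one_mul,
    Complex.norm_real, Real.norm_eq_abs, sq_abs, ← mul_pow]
  have h1 := sq_le_sq' (abs_le.1 (hB _ hmem)).1 (abs_le.1 (hB _ hmem)).2
  have h2 := sq_le_sq' (abs_le.1 (hC _ hmem)).1 (abs_le.1 (hC _ hmem)).2
  have h3 : r (coordSegment ρ₀ ρ₁ θ₀ θ₁ φ₀ φ₁ t) = Real.arccos (Real.cos (ρ₀ + t * (ρ₁ - ρ₀))) :=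
    rfl
  rw [h3]
  linarith

end segment

/-! ### The warping functions -/

lemma le_warp {a : ℝ} (β : ℝ) (ha : 0 < a) (ρ : ℝ) : β ≤ warp β a ρ := by
  have h := Real.sin_sq_le_one ρ
  have : 0 ≤ Real.log ((1 + a) / (Real.sin ρ ^ 2 + a)) :=
    Real.log_nonneg ((one_le_div (by positivity)).2 (by linarith))
  rw [warp]; linarith

lemma warp_anti {a b : ℝ} (β : ℝ) (ha : 0 < a) (hab : a ≤ b) (ρ : ℝ) : warp β b ρ ≤ warp β a ρ := by
  have h := Real.sin_sq_le_one ρ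
  have hb : 0 < b := ha.trans_le hab
  rw [warp, warp]
  gcongr ?_ + β
  refine Real.log_le_log (by positivity) ?_
  rw [div_le_div_iff₀ (by positivity) (by positivity)]
  nlinarith

lemma warp_le_warpLimit {a : ℝ} (β : ℝ) (ha : 0 < a) {ρ : ℝ} (hρ : Real.sin ρ ≠ 0) :
    warp β a ρ ≤ warpLimit β ρ := by
  have h := Real.sin_sq_le_one ρ
  rw [warp, warpLimit]
  gcongr ?_ + β
  refine Real.log_le_log (by positivity) ?_
  rw [div_le_div_iff₀ (by positivity) (by positivity)]
  nlinarith

lemma le_warpLimit (β ρ : ℝ) : β ≤ warpLimit β ρ := by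
  have h := Real.sin_sq_le_one ρ
  rcases eq_or_ne (Real.sin ρ) 0 with h0 | h0
  · simp [warpLimit, h0]
  · have : 0 ≤ Real.log (1 / Real.sin ρ ^ 2) :=
      Real.log_nonneg ((one_le_div (by positivity)).2 (by linarith))
    rw [warpLimit]; linarith

/-- The extreme warping function decreases with the distance to the poles. -/
lemma warpLimit_le {β ρ η : ℝ} (hη : 0 < Real.sin η) (h : Real.sin η ≤ Real.sin ρ) :
    warpLimit β ρ ≤ warpLimit β η := by
  rw [warpLimit, warpLimit]
  gcongr ?_ + β
  have := hη.trans_le h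
  refine Real.log_le_log (by positivity) ?_
  gcongr

lemma continuous_warp {a : ℝ} (β : ℝ) (ha : 0 < a) : Continuous fun p : M => warp β a (r p) := by
  have h : Continuous fun p : M => Real.sin (r p) ^ 2 + a :=
    ((Real.continuous_sin.comp continuous_r).pow 2).add continuous_const
  unfold warp
  have hpos : ∀ p : M, 0 < Real.sin (r p) ^ 2 + a := fun p => by positivity
  exact ((continuous_const.div h fun p => (hpos p).ne').log
    fun p => (div_pos (by positivity) (hpos p)).ne').add continuous_const

lemma sin_r_ne_zero {p : M} (hp : p ∈ Sᶜ) : Real.sin (r p) ≠ 0 := by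
  have h := sin_r_sq p
  have := mem_compl_S.1 hp
  intro h0
  rw [h0] at h
  linarith

lemma sin_r_pos {p : M} (hp : p ∈ Sᶜ) : 0 < Real.sin (r p) :=
  lt_of_le_of_ne (Real.sin_nonneg_of_mem_Icc (r_mem p)) (sin_r_ne_zero hp).symm

lemma continuousOn_warpLimit (β : ℝ) : ContinuousOn (fun p : M => warpLimit β (r p)) Sᶜ := by
  have h : ContinuousOn (fun p : M => Real.sin (r p) ^ 2) Sᶜ :=
    ((Real.continuous_sin.comp continuous_r).pow 2).continuousOn
  unfold warpLimit
  refine ((continuousOn_const.div h fun p hp => ?_).log fun p hp => ?_).add continuousOn_const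
  · exact pow_ne_zero 2 (sin_r_ne_zero hp)
  · exact one_div_ne_zero (pow_ne_zero 2 (sin_r_ne_zero hp))

/-! ### Riemannian distances are distance functions -/

lemma exists_isCurve_univ (p q : M) : ∃ c, IsCurve univ p q c := by
  obtain ⟨θ, -, φ, -, h⟩ := exists_polar p
  obtain ⟨θ', -, φ', -, h'⟩ := exists_polar q
  rw [h, h']
  exact ⟨_, isCurve_coordSegment fun _ _ _ _ => mem_univ _⟩

lemma sin_pos_of_mem_uIcc {x y : ℝ} (hx : x ∈ Ioo 0 Real.pi) (hy : y ∈ Ioo 0 Real.pi) {ρ : ℝ}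
    (h : ρ ∈ uIcc x y) : 0 < Real.sin ρ := by
  rcases h with ⟨h1, h2⟩
  exact Real.sin_pos_of_pos_of_lt_pi (lt_of_lt_of_le (lt_min hx.1 hy.1) h1)
    (h2.trans_lt (max_lt hx.2 hy.2))

lemma r_mem_Ioo {p : M} (hp : p ∈ Sᶜ) : r p ∈ Ioo 0 Real.pi := by
  have h := r_mem p
  have h0 := sin_r_ne_zero hp
  refine ⟨lt_of_le_of_ne h.1 fun h' => h0 ?_, lt_of_le_of_ne h.2 fun h' => h0 ?_⟩
  · rw [← h', Real.sin_zero]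
  · rw [h', Real.sin_pi]

lemma exists_isCurve_compl_S {p q : M} (hp : p ∈ Sᶜ) (hq : q ∈ Sᶜ) :
    ∃ c, IsCurve Sᶜ p q c := by
  obtain ⟨θ, -, φ, -, h⟩ := exists_polar p
  obtain ⟨θ', -, φ', -, h'⟩ := exists_polar q
  rw [h, h']
  exact ⟨_, isCurve_coordSegment fun ρ hρ θ φ =>
    point_mem_compl_S θ φ (sin_pos_of_mem_uIcc (r_mem_Ioo hp) (r_mem_Ioo hq) hρ).ne'⟩

lemma eq_of_riemannianDist_eq_zero {f : ℝ → ℝ} {U : Set M}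
    (hf : ContinuousOn (fun p => f (r p)) U) (hf1 : ∀ x ∈ U, 1 ≤ f (r x)) {p q : M}
    (hne : ∃ c, IsCurve U p q c) (h : riemannianDist f U p q = 0) : p = q := by
  have hmin := min_chord_le_riemannianDist (m := 1) (η := 1) hf
    (fun x hx => zero_le_one.trans (hf1 x hx)) hne zero_le_one fun x hx _ => hf1 x hx
  rw [h, min_le_iff, or_iff_left (by norm_num), Real.sqrt_le_left le_rfl] at hmin
  have h1 : ‖(q.1 : E3) - p.1‖ = 0 := by
    nlinarith [sq_nonneg ‖(q.1 : E3) - p.1‖, sq_nonneg ‖(q.2 : ℂ) - p.2‖]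
  have h2 : ‖(q.2 : ℂ) - p.2‖ = 0 := by
    nlinarith [sq_nonneg ‖(q.1 : E3) - p.1‖, sq_nonneg ‖(q.2 : ℂ) - p.2‖]
  exact Prod.ext (Subtype.ext (sub_eq_zero.1 (norm_eq_zero.1 h1)).symm)
    (Circle.ext (sub_eq_zero.1 (norm_eq_zero.1 h2)).symm)

lemma isMetric_riemannianDist_univ {f : ℝ → ℝ} (hf : Continuous fun p => f (r p))
    (hf1 : ∀ ρ, 1 ≤ f ρ) : IsMetric (riemannianDist f univ) where
  dist_self p := riemannianDist_self (mem_univ p)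
  dist_comm _ _ := riemannianDist_comm
  dist_triangle _ _ _ := riemannianDist_triangle hf.continuousOn (exists_isCurve_univ _ _)
    (exists_isCurve_univ _ _)
  eq_of_dist_eq_zero h := eq_of_riemannianDist_eq_zero hf.continuousOn (fun _ _ => hf1 _)
    (exists_isCurve_univ _ _) h

lemma isMetric_d₀ : IsMetric d₀ := isMetric_riemannianDist_univ continuous_const fun _ => le_rfl

lemma isMetric_dWarp {β a : ℝ} (hβ : 1 ≤ β) (ha : 0 < a) : IsMetric (dWarp β a) :=
  isMetric_riemannianDist_univ (continuous_warp β ha) fun ρ => hβ.trans (le_warp β ha ρ)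

lemma dExtreme_triangle (β : ℝ) {p q s : M} (hp : p ∈ Sᶜ) (hq : q ∈ Sᶜ) (hs : s ∈ Sᶜ) :
    riemannianDist (warpLimit β) Sᶜ p s ≤
      riemannianDist (warpLimit β) Sᶜ p q + riemannianDist (warpLimit β) Sᶜ q s :=
  riemannianDist_triangle (continuousOn_warpLimit β) (exists_isCurve_compl_S hp hq)
    (exists_isCurve_compl_S hq hs)

lemma isMetric_dExtreme {β : ℝ} (hβ : 1 ≤ β) : IsMetric (dExtreme β) where
  dist_self p := riemannianDist_self p.2
  dist_comm _ _ := riemannianDist_comm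
  dist_triangle p q s := dExtreme_triangle β p.2 q.2 s.2
  eq_of_dist_eq_zero {p q} h := Subtype.ext (eq_of_riemannianDist_eq_zero
    (continuousOn_warpLimit β) (fun _ _ => hβ.trans (le_warpLimit β _))
    (exists_isCurve_compl_S p.2 q.2) h)

/-! ### A common modulus of continuity -/

/-- An upper bound for `d` in the coordinates `(r, θ, φ)`, shared by all the distances under
consideration: in order to turn in the direction `φ` one first moves away from the poles by `η`,
to where the warping function is at most `warpLimit β η`. -/
def HasPolarModulus (β : ℝ) (d : M → M → ℝ) : Prop :=
  ∀ ρ ∈ Icc 0 Real.pi, ∀ ρ' ∈ Icc 0 Real.pi, ∀ θ θ' φ φ' : ℝ, ∀ η ∈ Ioc 0 (Real.pi / 2),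
    d (point ρ θ φ) (point ρ' θ' φ') ≤
      |ρ' - ρ| + |θ' - θ| + (2 * η + warpLimit β η * |φ' - φ|)

lemma hasPolarModulus_riemannianDist {β : ℝ} {f : ℝ → ℝ} (hf : Continuous fun p => f (r p))
    (hf0 : ∀ ρ, 0 ≤ f ρ) (hle : ∀ ρ, Real.sin ρ ≠ 0 → f ρ ≤ warpLimit β ρ) :
    HasPolarModulus β (riemannianDist f univ) := by
  intro ρ hρ ρ' hρ' θ θ' φ φ' η hη
  have hpi := Real.pi_pos
  have htri : ∀ p q s : M, riemannianDist f univ p s ≤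
      riemannianDist f univ p q + riemannianDist f univ q s := fun p q s =>
    riemannianDist_triangle hf.continuousOn (exists_isCurve_univ _ _) (exists_isCurve_univ _ _)
  have hmeridian : ∀ x y θ φ : ℝ, riemannianDist f univ (point x θ φ) (point y θ φ) ≤ |y - x| := by
    intro x y θ φ
    refine (riemannianDist_point_le (B := 0) (C := 0) (by simp) (by simp) (by simp)).trans_eq ?_
    simp [Real.sqrt_sq_eq_abs]
  have hparallel : riemannianDist f univ (point ρ' θ φ) (point ρ' θ' φ) ≤ |θ' - θ| := by
    refine (riemannianDist_point_le (B := |θ' - θ|) (C := 0) (by simp) (fun x _ => ?_)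
      (by simp)).trans_eq (by simp [Real.sqrt_sq_eq_abs])
    rw [abs_mul]
    exact mul_le_of_le_one_left (abs_nonneg _) (Real.abs_sin_le_one x)
  -- the point of `[η, π - η]` next to `ρ'`
  obtain ⟨x, hx, hxρ⟩ : ∃ x ∈ Icc η (Real.pi - η), |x - ρ'| ≤ η := by
    refine ⟨max η (min ρ' (Real.pi - η)), ⟨le_max_left _ _, max_le (by linarith [hη.2])
      (min_le_right _ _)⟩, abs_le.2 ⟨?_, ?_⟩⟩
    · rcases le_total ρ' (Real.pi - η) with h | h
      · rw [min_eq_left h]; linarith [le_max_right η ρ', hη.1]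
      · rw [min_eq_right h]; linarith [le_max_right η (Real.pi - η), hρ'.2]
    · rw [sub_le_iff_le_add]
      exact max_le (by linarith [hρ'.1]) ((min_le_left _ _).trans (by linarith [hη.1]))
  have hsinη : 0 < Real.sin η := Real.sin_pos_of_pos_of_lt_pi hη.1 (by linarith [hη.2])
  have hsinx : Real.sin η ≤ Real.sin x := by
    rcases le_total x (Real.pi / 2) with h | h
    · exact Real.sin_le_sin_of_le_of_le_pi_div_two (by linarith [hη.1]) h hx.1
    · rw [← Real.sin_pi_sub x]
      exact Real.sin_le_sin_of_le_of_le_pi_div_two (by linarith [hη.1]) (by linarith)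
        (by linarith [hx.2])
  have hW : 0 ≤ warpLimit β η := (hf0 η).trans (hle η hsinη.ne')
  have hrot : riemannianDist f univ (point x θ' φ) (point x θ' φ') ≤
      warpLimit β η * |φ' - φ| := by
    refine (riemannianDist_point_le (B := 0) (C := warpLimit β η * |φ' - φ|) (by simp)
      (by simp) fun y hy => ?_).trans_eq ?_
    · rw [uIcc_self, mem_singleton_iff] at hy
      rw [hy, abs_mul, Real.arccos_cos (hη.1.le.trans hx.1) (by linarith [hx.2, hη.1]),
        abs_of_nonneg (hf0 x)]
      gcongr
      exact (hle x (hsinη.trans_le hsinx).ne').trans (warpLimit_le hsinη hsinx)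
    · simp [Real.sqrt_sq_eq_abs, abs_mul, abs_of_nonneg hW]
  have h1 := htri (point ρ θ φ) (point ρ' θ φ) (point ρ' θ' φ')
  have h2 := htri (point ρ' θ φ) (point ρ' θ' φ) (point ρ' θ' φ')
  have h3 := htri (point ρ' θ' φ) (point x θ' φ) (point ρ' θ' φ')
  have h4 := htri (point x θ' φ) (point x θ' φ') (point ρ' θ' φ')
  have h5 := hmeridian ρ ρ' θ φ
  have h6 := hmeridian ρ' x θ' φ
  have h7 := hmeridian x ρ' θ' φ'
  rw [abs_sub_comm] at h7
  linarith

lemma hasPolarModulus_d₀ {β : ℝ} (hβ : 1 ≤ β) : HasPolarModulus β d₀ :=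
  hasPolarModulus_riemannianDist continuous_const (fun _ => zero_le_one)
    fun ρ _ => hβ.trans (le_warpLimit β ρ)

lemma hasPolarModulus_dWarp {β a : ℝ} (hβ : 1 ≤ β) (ha : 0 < a) :
    HasPolarModulus β (dWarp β a) :=
  hasPolarModulus_riemannianDist (continuous_warp β ha)
    (fun ρ => zero_le_one.trans (hβ.trans (le_warp β ha ρ))) fun _ h => warp_le_warpLimit β ha h

section topology

variable {β : ℝ} {d : M → M → ℝ}

/-- The compact box of coordinates maps onto `S² × S¹` by a quotient map, so that continuity can be
tested in coordinates. -/
lemma HasPolarModulus.continuous_of (hd : HasPolarModulus β d) (h : IsMetric d) :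
    Continuous (Space.of h) := by
  have hpi := Real.pi_pos
  let K : Set (ℝ × ℝ × ℝ) := Icc 0 Real.pi ×ˢ Icc 0 (2 * Real.pi) ×ˢ Icc 0 (2 * Real.pi)
  have hK : IsCompact K := isCompact_Icc.prod (isCompact_Icc.prod isCompact_Icc)
  have : CompactSpace K := isCompact_iff_compactSpace.1 hK
  let P : K → M := fun x => point x.1.1 x.1.2.1 x.1.2.2
  have hP : Continuous P := continuous_point.comp continuous_subtype_val
  have hsurj : Function.Surjective P := by
    intro p
    obtain ⟨θ, hθ, φ, hφ, hp⟩ := exists_polar p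
    exact ⟨⟨(r p, θ, φ), r_mem p, Ico_subset_Icc_self hθ, Ico_subset_Icc_self hφ⟩, hp.symm⟩
  rw [(IsQuotientMap.of_surjective_continuous hsurj hP).continuous_iff, Metric.continuous_iff]
  intro y ε hε
  set η := min (ε / 8) (Real.pi / 2) with hη
  set W := warpLimit β η with hW
  have hη0 : 0 < η := lt_min (by positivity) (by positivity)
  have hη1 : η ≤ ε / 8 := min_le_left _ _
  have hW0 := abs_nonneg W
  refine ⟨ε / (8 * (|W| + 1)), by positivity, fun x hxy => ?_⟩
  rw [lt_div_iff₀ (by positivity)] at hxy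
  have hD : 0 ≤ dist x y := dist_nonneg
  have h0 : |y.1.1 - x.1.1| ≤ dist x y := by
    rw [abs_sub_comm, ← Real.dist_eq]
    exact le_max_left _ _
  have h1 : |y.1.2.1 - x.1.2.1| ≤ dist x y := by
    rw [abs_sub_comm, ← Real.dist_eq]
    exact (le_max_left _ _).trans (le_max_right (dist x.1.1 y.1.1) (dist x.1.2 y.1.2))
  have h2 : |y.1.2.2 - x.1.2.2| ≤ dist x y := by
    rw [abs_sub_comm, ← Real.dist_eq]
    exact (le_max_right _ _).trans (le_max_right (dist x.1.1 y.1.1) (dist x.1.2 y.1.2))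
  have h3 : W * |y.1.2.2 - x.1.2.2| ≤ |W| * dist x y :=
    mul_le_mul (le_abs_self _) h2 (abs_nonneg _) hW0
  have h4 := hd _ x.2.1 _ y.2.1 x.1.2.1 y.1.2.1 x.1.2.2 y.1.2.2 η ⟨hη0, min_le_right _ _⟩
  change d (P x) (P y) < ε
  have h5 : d (P x) (P y) ≤ _ := h4
  nlinarith

/-- `S² × S¹` is homeomorphic to the metric space given by a distance function with the modulus of
continuity above. -/
def HasPolarModulus.homeomorph (hd : HasPolarModulus β d) (h : IsMetric d) : M ≃ₜ Space h :=
  Continuous.homeoOfEquivCompactToT2 (f := ⟨Space.of h, Space.pt, fun _ => rfl, fun _ => rfl⟩)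
    (hd.continuous_of h)

lemma HasPolarModulus.compactSpace (hd : HasPolarModulus β d) (h : IsMetric d) :
    CompactSpace (Space h) :=
  (hd.homeomorph h).compactSpace

lemma HasPolarModulus.continuous (hd : HasPolarModulus β d) (h : IsMetric d) :
    Continuous fun x : M × M => d x.1 x.2 :=
  ((hd.continuous_of h).comp continuous_fst).dist ((hd.continuous_of h).comp continuous_snd)

lemma HasPolarModulus.isHomeomorph {d' : M → M → ℝ} (hd : HasPolarModulus β d)
    (hd' : HasPolarModulus β d') (h : IsMetric d) (h' : IsMetric d') :
    IsHomeomorph fun p : Space h => Space.of h' p.pt :=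
  ((hd.homeomorph h).symm.trans (hd'.homeomorph h')).isHomeomorph

lemma HasPolarModulus.bounded (hd : HasPolarModulus β d) (p q : M) :
    d p q ≤ 4 * Real.pi + |warpLimit β (Real.pi / 2)| * (2 * Real.pi) := by
  have hpi := Real.pi_pos
  obtain ⟨θ, hθ, φ, hφ, hp⟩ := exists_polar p
  obtain ⟨θ', hθ', φ', hφ', hq⟩ := exists_polar q
  have h := hd _ (r_mem p) _ (r_mem q) θ θ' φ φ' (Real.pi / 2) ⟨by positivity, le_rfl⟩
  rw [← hp, ← hq] at h
  have h1 : |r q - r p| ≤ Real.pi := abs_sub_le_iff.2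
    ⟨by linarith [(r_mem q).2, (r_mem p).1], by linarith [(r_mem p).2, (r_mem q).1]⟩
  have h2 : |θ' - θ| ≤ 2 * Real.pi := abs_sub_le_iff.2
    ⟨by linarith [hθ'.2, hθ.1], by linarith [hθ.2, hθ'.1]⟩
  have h3 : |φ' - φ| ≤ 2 * Real.pi := abs_sub_le_iff.2
    ⟨by linarith [hφ'.2, hφ.1], by linarith [hφ.2, hφ'.1]⟩
  have h4 := mul_le_mul (le_abs_self (warpLimit β (Real.pi / 2))) h3 (abs_nonneg _) (abs_nonneg _)
  linarith

end topology

/-! ### The limit distance -/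

section limit

variable {β : ℝ} {a : ℕ → ℝ}

/-- The limit distance `d_∞ = sup_j d_j`. -/
def dLim (β : ℝ) (a : ℕ → ℝ) (p q : M) : ℝ := ⨆ j, dWarp β (a j) p q

lemma length_warp_mono {f g : ℝ → ℝ} {U V : Set M} (hf : ContinuousOn (fun p => f (r p)) U)
    (hg : ContinuousOn (fun p => g (r p)) V) {p q : M} {c : ℝ → M} (hc : IsCurve U p q c)
    (hV : IsCurve V p q c)
    (hf0 : ∀ ρ, 0 ≤ f ρ) (hfg : ∀ x ∈ U, x ∈ V → f (r x) ≤ g (r x)) : length f c ≤ length g c := by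
  rw [length_eq_integral_speed, length_eq_integral_speed]
  refine intervalIntegral.integral_mono_on zero_le_one
    ((continuousOn_speed hf hc.1 subset_rfl hc.mem).intervalIntegrable_of_Icc zero_le_one)
    ((continuousOn_speed hg hV.1 subset_rfl hV.mem).intervalIntegrable_of_Icc zero_le_one)
    fun t ht => ?_
  have := hfg _ (hc.mem t ht) (hV.mem t ht)
  have := hf0 (r (c t))
  rw [speed, speed, warpedTensor_self, warpedTensor_self]
  gcongr

lemma dWarp_anti {a b : ℝ} (hβ : 0 ≤ β) (ha : 0 < a) (hab : a ≤ b) (p q : M) :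
    dWarp β b p q ≤ dWarp β a p q := by
  have hb := ha.trans_le hab
  refine le_riemannianDist (exists_isCurve_univ p q) fun c hc => hc.riemannianDist_le.trans ?_
  exact length_warp_mono (continuous_warp β hb).continuousOn (continuous_warp β ha).continuousOn
    hc hc (fun ρ => hβ.trans (le_warp β hb ρ)) fun x _ _ => warp_anti β ha hab _

lemma dWarp_le_dExtreme {a : ℝ} (hβ : 0 ≤ β) (ha : 0 < a) {p q : M} (hp : p ∈ Sᶜ) (hq : q ∈ Sᶜ) :
    dWarp β a p q ≤ riemannianDist (warpLimit β) Sᶜ p q := by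
  refine le_riemannianDist (exists_isCurve_compl_S hp hq) fun c hc => ?_
  have hc' : IsCurve univ p q c := ⟨hc.1, fun _ _ => mem_univ _, hc.3, hc.4⟩
  exact hc'.riemannianDist_le.trans (length_warp_mono (continuous_warp β ha).continuousOn
    (continuousOn_warpLimit β) hc' hc (fun ρ => hβ.trans (le_warp β ha ρ))
    fun x _ hx => warp_le_warpLimit β ha (sin_r_ne_zero hx))

variable (hβ : 1 ≤ β) (ha_pos : ∀ j, 0 < a j) (ha_anti : Antitone a)
include hβ ha_pos

lemma bddAbove_dWarp (p q : M) : BddAbove (range fun j => dWarp β (a j) p q) :=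
  ⟨_, forall_mem_range.2 fun j => (hasPolarModulus_dWarp hβ (ha_pos j)).bounded p q⟩

lemma dWarp_le_dLim (j : ℕ) (p q : M) : dWarp β (a j) p q ≤ dLim β a p q :=
  le_ciSup (bddAbove_dWarp hβ ha_pos p q) j

lemma isLUB_dLim (p q : M) : IsLUB (range fun j => dWarp β (a j) p q) (dLim β a p q) :=
  isLUB_ciSup (bddAbove_dWarp hβ ha_pos p q)

lemma hasPolarModulus_dLim : HasPolarModulus β (dLim β a) :=
  fun ρ hρ ρ' hρ' θ θ' φ φ' η hη => ciSup_le fun j =>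
    hasPolarModulus_dWarp hβ (ha_pos j) ρ hρ ρ' hρ' θ θ' φ φ' η hη

lemma isMetric_dLim : IsMetric (dLim β a) where
  dist_self p := by
    simp [dLim, fun j => (isMetric_dWarp hβ (ha_pos j)).dist_self p]
  dist_comm p q := by
    simp [dLim, fun j => (isMetric_dWarp hβ (ha_pos j)).dist_comm p q]
  dist_triangle p q s := ciSup_le fun j =>
    ((isMetric_dWarp hβ (ha_pos j)).dist_triangle p q s).trans
      (add_le_add (dWarp_le_dLim hβ ha_pos j p q) (dWarp_le_dLim hβ ha_pos j q s))
  eq_of_dist_eq_zero {p q} h := (isMetric_dWarp hβ (ha_pos 0)).eq_of_dist_eq_zero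
    (le_antisymm (h ▸ dWarp_le_dLim hβ ha_pos 0 p q) riemannianDist_nonneg)

include ha_anti

lemma monotone_dWarp (p q : M) : Monotone fun j => dWarp β (a j) p q := fun _ j hij =>
  dWarp_anti (zero_le_one.trans hβ) (ha_pos j) (ha_anti hij) p q

lemma tendsto_dWarp (p q : M) :
    Tendsto (fun j => dWarp β (a j) p q) atTop (𝓝 (dLim β a p q)) :=
  tendsto_atTop_isLUB (monotone_dWarp hβ ha_pos ha_anti p q) (isLUB_dLim hβ ha_pos p q)

lemma tendstoUniformly_dWarp :
    TendstoUniformly (fun j (x : M × M) => dWarp β (a j) x.1 x.2) (fun x => dLim β a x.1 x.2)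
      atTop :=
  Monotone.tendstoUniformly_of_forall_tendsto
    (fun j => (hasPolarModulus_dWarp hβ (ha_pos j)).continuous (isMetric_dWarp hβ (ha_pos j)))
    (fun _ _ hij x => monotone_dWarp hβ ha_pos ha_anti x.1 x.2 hij)
    ((hasPolarModulus_dLim hβ ha_pos).continuous (isMetric_dLim hβ ha_pos))
    fun x => tendsto_dWarp hβ ha_pos ha_anti x.1 x.2

end limit

/-- Distance functions on one set that converge uniformly converge in the Gromov–Hausdorff sense. -/
lemma tendsto_ghDist {X : Type} [Nonempty X] {d : ℕ → X → X → ℝ} {d' : X → X → ℝ}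
    (h : ∀ j, IsMetric (d j)) (h' : IsMetric d') [∀ j, CompactSpace (Space (h j))]
    [CompactSpace (Space h')]
    (hu : TendstoUniformly (fun j (x : X × X) => d j x.1 x.2) (fun x => d' x.1 x.2) atTop) :
    Tendsto (fun j => GromovHausdorff.ghDist (Space (h j)) (Space h')) atTop (𝓝 0) := by
  rw [Metric.tendsto_atTop]
  rw [Metric.tendstoUniformly_iff] at hu
  intro ε hε
  obtain ⟨N, hN⟩ := eventually_atTop.1 (hu ε hε)
  refine ⟨N, fun j hj => ?_⟩
  have hle : GromovHausdorff.ghDist (Space (h j)) (Space h') ≤ 0 + ε / 2 + 0 := by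
    refine GromovHausdorff.ghDist_le_of_approx_subsets
      (fun x : (univ : Set (Space (h j))) => Space.of h' x.1.pt) (fun x => ⟨x, mem_univ _, by simp⟩)
      (fun x => ⟨⟨Space.of (h j) x.pt, mem_univ _⟩, (dist_self x).le⟩) fun x y => ?_
    have := hN j hj (x.1.pt, y.1.pt)
    rw [dist_comm, Real.dist_eq] at this
    exact this.le
  have h0 : 0 ≤ GromovHausdorff.ghDist (Space (h j)) (Space h') := dist_nonneg
  rw [Real.dist_eq, sub_zero, abs_of_nonneg h0]
  linarith

/-! ### The limit distance away from the singular set -/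

/-- The map `(r, ·, φ) ↦ (arccos (l cos r), θ, φ)`, which for `|l| < 1` moves every point away from
the singular set. -/
def push (l θ : ℝ) (p : M) : M := ((point (Real.arccos (l * (p.1 : E3) 2)) θ 0).1, p.2)

lemma push_point (l θ ρ θ' φ : ℝ) :
    push l θ (point ρ θ' φ) = point (Real.arccos (l * Real.cos ρ)) θ φ := rfl

/-- The factor `l` with `1 - l² z² = (1 - z² + a) / (1 + a)`, for which `push l θ` turns the warping
function `warp β a` into `warpLimit β`. -/
def pushFactor (a : ℝ) : ℝ := Real.sqrt (1 / (1 + a))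

lemma pushFactor_sq {a : ℝ} (ha : 0 < a) : pushFactor a ^ 2 = 1 / (1 + a) :=
  Real.sq_sqrt (by positivity)

lemma pushFactor_nonneg (a : ℝ) : 0 ≤ pushFactor a := Real.sqrt_nonneg _

lemma pushFactor_sq_lt_one {a : ℝ} (ha : 0 < a) : pushFactor a ^ 2 < 1 := by
  rw [pushFactor_sq ha, div_lt_one (by positivity)]; linarith

lemma pushFactor_le_one {a : ℝ} (ha : 0 < a) : pushFactor a ≤ 1 := by
  nlinarith [pushFactor_sq_lt_one ha, pushFactor_nonneg a]

lemma one_sub_pushFactor_le {a : ℝ} (ha : 0 < a) : 1 - pushFactor a ≤ a := by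
  have h : 1 - pushFactor a ^ 2 ≤ a := by
    rw [pushFactor_sq ha, sub_le_iff_le_add, ← sub_le_iff_le_add', le_div_iff₀ (by positivity)]
    nlinarith
  nlinarith [pushFactor_le_one ha, pushFactor_nonneg a]

lemma pushFactor_mul_mem {a : ℝ} (ha : 0 < a) {z : ℝ} (hz : z ∈ Icc (-1 : ℝ) 1) :
    pushFactor a * z ∈ Ioo (-1 : ℝ) 1 := by
  rw [mem_Ioo, ← abs_lt, ← sq_lt_one_iff_abs_lt_one, mul_pow]
  have h : z ^ 2 ≤ 1 := (sq_le_one_iff_abs_le_one z).2 (abs_le.2 hz)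
  exact (mul_le_of_le_one_right (sq_nonneg _) h).trans_lt (pushFactor_sq_lt_one ha)

lemma push_height {a : ℝ} (ha : 0 < a) (θ : ℝ) (p : M) :
    ((push (pushFactor a) θ p).1 : E3) 2 = pushFactor a * (p.1 : E3) 2 := by
  have h := pushFactor_mul_mem ha (height_mem p.1)
  exact Real.cos_arccos h.1.le h.2.le

lemma push_mem {a : ℝ} (ha : 0 < a) (θ : ℝ) (p : M) : push (pushFactor a) θ p ∈ Sᶜ := by
  rw [mem_compl_S, push_height ha, sq_lt_one_iff_abs_lt_one, abs_lt]
  exact pushFactor_mul_mem ha (height_mem p.1)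

lemma warpLimit_push {a : ℝ} (ha : 0 < a) (β θ : ℝ) (p : M) :
    warpLimit β (r (push (pushFactor a) θ p)) = warp β a (r p) := by
  rw [warpLimit, warp, sin_r_sq, sin_r_sq, push_height ha, mul_pow, pushFactor_sq ha]
  have h : 1 - 1 / (1 + a) * (p.1 : E3) 2 ^ 2 = (1 - (p.1 : E3) 2 ^ 2 + a) / (1 + a) := by
    field_simp
    ring
  rw [h, one_div_div]

/-- The height along a curve changes at most with the speed of the spherical distance to a pole. -/
lemma velocity_height_sq_le {c : ℝ → M} (hc : ContDiffOn ℝ 1 (ambient c) (Icc 0 1)) {t : ℝ}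
    (ht : t ∈ Icc (0 : ℝ) 1) :
    (velocity c t).1 2 ^ 2 ≤ (1 - ((c t).1 : E3) 2 ^ 2) * ‖(velocity c t).1‖ ^ 2 := by
  have hd : HasDerivWithinAt (fun t => ((c t).1 : E3)) (velocity c t).1 (Icc 0 1) t :=
    (hasDerivWithinAt_ambient hc ht).fst
  have h1 := hd.norm_sq
  have h2 : HasDerivWithinAt (fun t => ‖((c t).1 : E3)‖ ^ 2) 0 (Icc 0 1) t := by
    simpa using hasDerivWithinAt_const t (Icc (0 : ℝ) 1) (1 : ℝ)
  have h3 := (uniqueDiffOn_Icc zero_lt_one t ht).eq_deriv _ h1 h2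
  have h4 := sum_sq_sphere (c t).1
  rw [EuclideanSpace.norm_sq_eq, Fin.sum_univ_three]
  simp only [PiLp.inner_apply, Fin.sum_univ_three, RCLike.inner_apply, conj_trivial] at h3
  simp only [Real.norm_eq_abs, sq_abs]
  set x := ((c t).1 : E3) 0
  set y := ((c t).1 : E3) 1
  set z := ((c t).1 : E3) 2
  set x' := (velocity c t).1 0
  set y' := (velocity c t).1 1
  set z' := (velocity c t).1 2
  have h5 : z * z' = -(x * x' + y * y') := by linarith
  have h6 : (z * z') ^ 2 ≤ (x ^ 2 + y ^ 2) * (x' ^ 2 + y' ^ 2) := by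
    rw [h5]; nlinarith [sq_nonneg (x * y' - y * x')]
  have h7 : x ^ 2 + y ^ 2 = 1 - z ^ 2 := by linarith
  rw [h7] at h6
  nlinarith

/-- Pushing a curve away from the singular set does not increase its length, if the length of the
new curve is measured with the extreme limit metric. -/
lemma exists_isCurve_push {a : ℝ} (ha : 0 < a) (β θ : ℝ) {U : Set M} {p q : M} {c : ℝ → M}
    (hc : IsCurve U p q c) :
    ∃ c', IsCurve Sᶜ (push (pushFactor a) θ p) (push (pushFactor a) θ q) c' ∧
      length (warpLimit β) c' ≤ length (warp β a) c := by
  set l := pushFactor a with hl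
  let z : ℝ → ℝ := fun t => ((c t).1 : E3) 2
  have hz : ContDiffOn ℝ 1 z (Icc 0 1) := (contDiffOn_euclidean.1 hc.1.fst) 2
  have hmem : ∀ t, l * z t ∈ Ioo (-1 : ℝ) 1 := fun t => pushFactor_mul_mem ha (height_mem _)
  let R : ℝ → ℝ := fun t => Real.arccos (l * z t)
  have hR : ContDiffOn ℝ 1 R (Icc 0 1) := fun t ht =>
    ContDiffAt.comp_contDiffWithinAt (g := Real.arccos) t
      (Real.contDiffAt_arccos (hmem t).1.ne' (hmem t).2.ne) ((contDiffOn_const.mul hz) t ht)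
  have hcurve : IsCurve Sᶜ (push l θ p) (push l θ q) fun t => push l θ (c t) :=
    ⟨(contDiffOn_sphere 0 hR contDiffOn_const).prodMk hc.1.snd, fun t _ => push_mem ha θ _,
      by simp only [hc.source], by simp only [hc.target]⟩
  refine ⟨_, hcurve, ?_⟩
  rw [length_eq_integral_speed, length_eq_integral_speed]
  refine intervalIntegral.integral_mono_on zero_le_one
    ((continuousOn_speed (continuousOn_warpLimit β) hcurve.1 subset_rfl
      hcurve.mem).intervalIntegrable_of_Icc zero_le_one)
    ((continuousOn_speed (continuous_warp β ha).continuousOn hc.1 subset_rfl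
      (mapsTo_univ _ _)).intervalIntegrable_of_Icc zero_le_one) fun t ht => ?_
  have hv := hasDerivWithinAt_ambient hc.1 ht
  have hz' : HasDerivWithinAt z ((velocity c t).1 2) (Icc 0 1) t :=
    (EuclideanSpace.proj (𝕜 := ℝ) (2 : Fin 3)).hasFDerivAt.comp_hasDerivWithinAt t hv.fst
  have hR' : HasDerivWithinAt R
      (-(1 / Real.sqrt (1 - (l * z t) ^ 2)) * (l * (velocity c t).1 2)) (Icc 0 1) t :=
    HasDerivAt.comp_hasDerivWithinAt (h₂ := Real.arccos) t
      (Real.hasDerivAt_arccos (hmem t).1.ne' (hmem t).2.ne) (hz'.const_mul l)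
  obtain ⟨v, hv', hvn⟩ := hasDerivWithinAt_sphere 0 hR' (hasDerivWithinAt_const t (Icc 0 1) θ)
  have hvel : velocity (fun t => push l θ (c t)) t = (v, (velocity c t).2) :=
    velocity_eq ht (hv'.prodMk hv.snd)
  rw [speed, speed, warpedTensor_self, warpedTensor_self, hvel, warpLimit_push ha, hvn]
  refine Real.sqrt_le_sqrt ?_
  gcongr
  have h1 : (z t) ^ 2 ≤ 1 := height_sq_le _
  have h2 : 0 < 1 - (l * z t) ^ 2 := by
    have := (sq_lt_one_iff_abs_lt_one _).2 (abs_lt.2 (hmem t))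
    linarith
  rw [zero_pow two_ne_zero, mul_zero, add_zero, mul_pow, neg_sq, div_pow, one_pow,
    Real.sq_sqrt h2.le, one_div_mul_eq_div, div_le_iff₀ h2, mul_pow]
  have h3 : (velocity c t).1 2 ^ 2 ≤ (1 - z t ^ 2) * ‖(velocity c t).1‖ ^ 2 :=
    velocity_height_sq_le hc.1 ht
  have h4 : l ^ 2 ≤ 1 := (pushFactor_sq_lt_one ha).le
  calc l ^ 2 * (velocity c t).1 2 ^ 2 ≤ l ^ 2 * ((1 - z t ^ 2) * ‖(velocity c t).1‖ ^ 2) := by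
        gcongr
    _ = ‖(velocity c t).1‖ ^ 2 * (l ^ 2 - (l * z t) ^ 2) := by ring
    _ ≤ ‖(velocity c t).1‖ ^ 2 * (1 - (l * z t) ^ 2) := by gcongr

/-- At distance at least `ε` from the axis, `warpLimit β` and `warp β a` are comparable. -/
lemma warpLimit_le_mul_warp {a β ε : ℝ} (hβ : 1 ≤ β) (ha : 0 < a) (hε : 0 < ε)
    (haε : a ≤ ε * ε ^ 2) {ρ : ℝ} (hρ : ε ^ 2 ≤ Real.sin ρ ^ 2) :
    warpLimit β ρ ≤ (1 + ε) * warp β a ρ := by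
  have hs : 0 < Real.sin ρ ^ 2 := lt_of_lt_of_le (by positivity) hρ
  have h1 : warpLimit β ρ ≤ warp β a ρ + ε := by
    have h2 : Real.log (1 / Real.sin ρ ^ 2) =
        Real.log ((1 + a) / (Real.sin ρ ^ 2 + a)) +
          Real.log ((Real.sin ρ ^ 2 + a) / (Real.sin ρ ^ 2 * (1 + a))) := by
      rw [← Real.log_mul (by positivity) (by positivity)]
      congr 1
      field_simp
    have h3 : Real.log ((Real.sin ρ ^ 2 + a) / (Real.sin ρ ^ 2 * (1 + a))) ≤ ε := by
      refine (Real.log_le_sub_one_of_pos (by positivity)).trans ?_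
      rw [sub_le_iff_le_add, div_le_iff₀ (by positivity)]
      nlinarith [mul_pos hs ha, mul_le_mul_of_nonneg_left hρ hε.le, mul_pos (mul_pos hε hs) ha]
    rw [warpLimit, warp, h2]
    linarith
  nlinarith [hβ.trans (le_warp β ha ρ)]

/-- The end points of a part of a curve that stays at distance at least `ε` from the axis are as
close for the extreme limit as the length for `warp β a` permits, up to the factor `1 + ε`. -/
lemma dExtreme_le_integral_speed {a β ε : ℝ} (hβ : 1 ≤ β) (ha : 0 < a) (hε : 0 < ε)
    (haε : a ≤ ε * ε ^ 2) {c : ℝ → M} (hc : ContDiffOn ℝ 1 (ambient c) (Icc 0 1)) {s t : ℝ}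
    (hs : 0 ≤ s) (hst : s ≤ t) (ht : t ≤ 1)
    (hfar : ∀ x ∈ Icc s t, ε ^ 2 ≤ Real.sin (r (c x)) ^ 2) :
    riemannianDist (warpLimit β) Sᶜ (c s) (c t) ≤
      (1 + ε) * ∫ x in s..t, speed (warp β a) c x := by
  have hsub : Icc s t ⊆ Icc 0 1 := Icc_subset_Icc hs ht
  have hmem : MapsTo c (Icc s t) Sᶜ := fun x hx => by
    have := hfar x hx
    rw [sin_r_sq] at this
    exact mem_compl_S.2 (by nlinarith)
  obtain ⟨c', hc', hl⟩ := exists_isCurve_restrict (warpLimit β) hc hs hst ht hmem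
  refine hc'.riemannianDist_le.trans (hl.trans_le ?_)
  rw [← intervalIntegral.integral_const_mul]
  refine intervalIntegral.integral_mono_on hst
    ((continuousOn_speed (continuousOn_warpLimit β) hc hsub
      hmem).intervalIntegrable_of_Icc hst)
    (((continuousOn_speed (continuous_warp β ha).continuousOn hc hsub
      (mapsTo_univ _ _)).const_smul (1 + ε)).intervalIntegrable_of_Icc hst) fun x hx => ?_
  have h1 := warpLimit_le_mul_warp hβ ha hε haε (hfar x hx)
  have h2 := zero_le_one.trans (hβ.trans (le_warpLimit β (r (c x))))
  have h3 := zero_le_one.trans (hβ.trans (le_warp β ha (r (c x))))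
  rw [speed, speed, warpedTensor_self, warpedTensor_self,
    ← Real.sqrt_sq (by positivity : 0 ≤ 1 + ε), ← Real.sqrt_mul (sq_nonneg _)]
  refine Real.sqrt_le_sqrt ?_
  have h4 := pow_le_pow_left₀ h2 h1 2
  rw [mul_pow] at h4
  rw [mul_add, ← mul_assoc]
  refine add_le_add ?_ (mul_le_mul_of_nonneg_right h4 (sq_nonneg _))
  exact le_mul_of_one_le_left (sq_nonneg _) (one_le_pow₀ (by linarith))

/-- For small `a`, a curve for `warp β a` can be replaced by one that avoids the singular set: the
part between the first and the last time where it comes `ε`-close to the singular set is pushed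
away, the coordinate `θ` is kept fixed there and corrected at the end, where turning is cheap. -/
lemma exists_dExtreme_le_dWarp {β ε : ℝ} (hβ : 1 ≤ β) (hε : 0 < ε) {p q : M}
    (hp : ε ^ 2 < Real.sin (r p) ^ 2) (hq : ε ^ 2 < Real.sin (r q) ^ 2) :
    ∃ δ > 0, ∀ a, 0 < a → a < δ →
      riemannianDist (warpLimit β) Sᶜ p q ≤
        (1 + ε) * dWarp β a p q + (2 * ε + 2 * Real.pi * ε) := by
  have hpi := Real.pi_pos
  obtain ⟨δ, hδ, hunif⟩ := Metric.uniformContinuousOn_iff.1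
    (isCompact_Icc.uniformContinuousOn_of_continuous
      (Real.continuous_arccos.continuousOn (s := Icc (-1 : ℝ) 1))) ε hε
  refine ⟨min δ (ε * ε ^ 2), by positivity, fun a ha haδ => ?_⟩
  have haε : a ≤ ε * ε ^ 2 := (haδ.trans_le (min_le_right _ _)).le
  have haδ : a < δ := haδ.trans_le (min_le_left _ _)
  set D := riemannianDist (warpLimit β) Sᶜ with hD
  set l := pushFactor a with hl
  suffices h : ∀ c, IsCurve univ p q c →
      D p q ≤ (1 + ε) * length (warp β a) c + (2 * ε + 2 * Real.pi * ε) by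
    have : (D p q - (2 * ε + 2 * Real.pi * ε)) / (1 + ε) ≤ dWarp β a p q :=
      le_riemannianDist (exists_isCurve_univ p q) fun c hc => by
        rw [div_le_iff₀ (by positivity)]
        linarith [h c hc]
    rw [div_le_iff₀ (by positivity)] at this
    linarith
  intro c hc
  have hsin : ContinuousOn (fun t => Real.sin (r (c t)) ^ 2) (Icc 0 1) :=
    ((Real.continuous_sin.comp continuous_r).pow 2).comp_continuousOn
      (continuousOn_of_ambient hc.1.continuousOn)
  by_cases hfar : ∀ t ∈ Icc (0 : ℝ) 1, ε ^ 2 ≤ Real.sin (r (c t)) ^ 2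
  · have h := dExtreme_le_integral_speed hβ ha hε haε hc.1 le_rfl zero_le_one le_rfl hfar
    rw [hc.source, hc.target, ← length_eq_integral_speed] at h
    have : 0 ≤ 2 * ε + 2 * Real.pi * ε := by positivity
    linarith
  -- the first and the last time where the curve is close to the axis
  push Not at hfar
  obtain ⟨t, ht, hnear⟩ := hfar
  let T : Set ℝ := Icc 0 1 ∩ (fun t => Real.sin (r (c t)) ^ 2) ⁻¹' Iic (ε ^ 2)
  have hTc : IsCompact T :=
    isCompact_Icc.of_isClosed_subset (hsin.preimage_isClosed_of_isClosed isClosed_Icc isClosed_Iic)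
      inter_subset_left
  have hTn : T.Nonempty := ⟨t, ht, hnear.le⟩
  obtain ⟨t₁, ⟨ht₁, hn₁⟩, hmin⟩ := hTc.exists_isLeast hTn
  obtain ⟨t₂, ⟨ht₂, hn₂⟩, hmax⟩ := hTc.exists_isGreatest hTn
  simp only [mem_preimage, mem_Iic] at hn₁ hn₂
  have h12 : t₁ ≤ t₂ := hmin ⟨ht₂, hn₂⟩
  have hfar₁ : ∀ x ∈ Icc 0 t₁, ε ^ 2 ≤ Real.sin (r (c x)) ^ 2 := by
    have h0 : t₁ ≠ 0 := fun h => by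
      rw [h, hc.source] at hn₁
      exact absurd hp hn₁.not_gt
    have hsub : Icc 0 t₁ ⊆ Icc 0 1 := Icc_subset_Icc_right ht₁.2
    have hcl : Icc 0 t₁ ⊆ closure (Ico 0 t₁) := (closure_Ico h0.symm).ge
    intro x hx
    refine ContinuousWithinAt.closure_le (f := fun _ => ε ^ 2)
      (g := fun t => Real.sin (r (c t)) ^ 2) (hcl hx) continuousWithinAt_const
      ((hsin x (hsub hx)).mono (Ico_subset_Icc_self.trans hsub)) fun y hy => ?_
    by_contra! hlt
    exact absurd (hmin ⟨hsub (Ico_subset_Icc_self hy), hlt.le⟩) hy.2.not_ge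
  have hfar₂ : ∀ x ∈ Icc t₂ 1, ε ^ 2 ≤ Real.sin (r (c x)) ^ 2 := by
    have h1 : t₂ ≠ 1 := fun h => by
      rw [h, hc.target] at hn₂
      exact absurd hq hn₂.not_gt
    have hsub : Icc t₂ 1 ⊆ Icc 0 1 := Icc_subset_Icc_left ht₂.1
    have hcl : Icc t₂ 1 ⊆ closure (Ioc t₂ 1) := (closure_Ioc h1).ge
    intro x hx
    refine ContinuousWithinAt.closure_le (f := fun _ => ε ^ 2)
      (g := fun t => Real.sin (r (c t)) ^ 2) (hcl hx) continuousWithinAt_const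
      ((hsin x (hsub hx)).mono (Ioc_subset_Icc_self.trans hsub)) fun y hy => ?_
    by_contra! hlt
    exact absurd (hmax ⟨hsub (Ioc_subset_Icc_self hy), hlt.le⟩) hy.1.not_ge
  have hfar_mem : ∀ x : M, ε ^ 2 ≤ Real.sin (r x) ^ 2 → x ∈ Sᶜ := fun x hx => by
    rw [sin_r_sq] at hx
    exact mem_compl_S.2 (by nlinarith)
  set x := c t₁ with hx
  set y := c t₂ with hy
  have hxS : x ∈ Sᶜ := hfar_mem _ (hfar₁ t₁ ⟨ht₁.1, le_rfl⟩)
  have hyS : y ∈ Sᶜ := hfar_mem _ (hfar₂ t₂ ⟨le_rfl, ht₂.2⟩)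
  have hpS : p ∈ Sᶜ := hfar_mem _ hp.le
  have hqS : q ∈ Sᶜ := hfar_mem _ hq.le
  obtain ⟨θ₁, hθ₁, φ₁, -, hxp⟩ := exists_polar x
  obtain ⟨θ₂, hθ₂, φ₂, -, hyp⟩ := exists_polar y
  have hmeridian : ∀ u v θ φ : ℝ, u ∈ Ioo 0 Real.pi → v ∈ Ioo 0 Real.pi →
      D (point u θ φ) (point v θ φ) ≤ |v - u| := by
    intro u v θ φ hu hv
    refine (riemannianDist_point_le (B := 0) (C := 0) (fun ρ hρ θ φ =>
      point_mem_compl_S θ φ (sin_pos_of_mem_uIcc hu hv hρ).ne') (by simp) (by simp)).trans_eq ?_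
    simp [Real.sqrt_sq_eq_abs]
  -- points close to the axis are not pushed far
  have hclose : ∀ w : M, w ∈ Sᶜ → |Real.arccos (l * Real.cos (r w)) - r w| ≤ ε ∧
      Real.arccos (l * Real.cos (r w)) ∈ Ioo 0 Real.pi := by
    intro w hw
    have hz := height_mem w.1
    have hlz := pushFactor_mul_mem ha hz
    rw [cos_r]
    refine ⟨(hunif _ (Ioo_subset_Icc_self hlz) _ hz ?_).le, ?_, ?_⟩
    · rw [Real.dist_eq, ← sub_one_mul, abs_mul, abs_sub_comm,
        abs_of_nonneg (by linarith [pushFactor_le_one ha])]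
      exact (mul_le_of_le_one_right (by linarith [pushFactor_le_one ha])
        (abs_le.2 hz)).trans_lt ((one_sub_pushFactor_le ha).trans_lt haδ)
    · exact Real.arccos_pos.2 hlz.2
    · exact lt_of_le_of_ne (Real.arccos_le_pi _) fun h => hlz.1.not_ge (Real.arccos_eq_pi.1 h)
  have hI₁ : D p x ≤ (1 + ε) * ∫ t in (0 : ℝ)..t₁, speed (warp β a) c t := by
    have := dExtreme_le_integral_speed hβ ha hε haε hc.1 le_rfl ht₁.1 ht₁.2 hfar₁
    rwa [hc.source] at this
  have hI₃ : D y q ≤ (1 + ε) * ∫ t in t₂..1, speed (warp β a) c t := by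
    have := dExtreme_le_integral_speed hβ ha hε haε hc.1 ht₂.1 ht₂.2 le_rfl hfar₂
    rwa [hc.target] at this
  have hI₂ : D (push l θ₁ x) (push l θ₁ y) ≤ ∫ t in t₁..t₂, speed (warp β a) c t := by
    obtain ⟨c₁, hc₁, hl₁⟩ := exists_isCurve_restrict (warp β a) hc.1 ht₁.1 h12 ht₂.2
      (mapsTo_univ _ _)
    obtain ⟨c₂, hc₂, hl₂⟩ := exists_isCurve_push ha β θ₁ hc₁
    exact hc₂.riemannianDist_le.trans (hl₂.trans_eq hl₁)
  have hJ₁ : D x (push l θ₁ x) ≤ ε := by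
    have h := hmeridian (r x) _ θ₁ φ₁ (r_mem_Ioo hxS) (hclose x hxS).2
    rw [← push_point l θ₁ (r x) θ₁ φ₁, ← hxp] at h
    exact h.trans (hclose x hxS).1
  have hJ₂ : D (push l θ₁ y) (point (r y) θ₁ φ₂) ≤ ε := by
    have h := hmeridian _ (r y) θ₁ φ₂ (hclose y hyS).2 (r_mem_Ioo hyS)
    rw [← push_point l θ₁ (r y) θ₂ φ₂, ← hyp, abs_sub_comm] at h
    exact h.trans (hclose y hyS).1
  have hJ₃ : D (point (r y) θ₁ φ₂) y ≤ 2 * Real.pi * ε := by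
    have h : D (point (r y) θ₁ φ₂) (point (r y) θ₂ φ₂) ≤ 2 * Real.pi * ε := by
      refine (riemannianDist_point_le (B := 2 * Real.pi * ε) (C := 0) (fun ρ hρ θ φ => ?_)
        (fun ρ hρ => ?_) (by simp)).trans_eq ?_
      · exact point_mem_compl_S θ φ (sin_pos_of_mem_uIcc (r_mem_Ioo hyS) (r_mem_Ioo hyS) hρ).ne'
      · rw [uIcc_self, mem_singleton_iff] at hρ
        rw [hρ, abs_mul, mul_comm]
        have h1 : |θ₂ - θ₁| ≤ 2 * Real.pi := abs_sub_le_iff.2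
          ⟨by linarith [hθ₂.2, hθ₁.1], by linarith [hθ₁.2, hθ₂.1]⟩
        have h2 : |Real.sin (r y)| ≤ ε := abs_le_of_sq_le_sq hn₂ hε.le
        gcongr
      · have : 0 ≤ 2 * Real.pi * ε := by positivity
        simp [Real.sqrt_sq this]
    rwa [← hyp] at h
  have hint : length (warp β a) c = (∫ t in (0 : ℝ)..t₁, speed (warp β a) c t) +
      (∫ t in t₁..t₂, speed (warp β a) c t) + ∫ t in t₂..1, speed (warp β a) c t := by
    have hcont := continuousOn_speed (continuous_warp β ha).continuousOn hc.1 subset_rfl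
      (mapsTo_univ _ _)
    have hi : ∀ u v : ℝ, 0 ≤ u → u ≤ v → v ≤ 1 →
        IntervalIntegrable (speed (warp β a) c) volume u v := fun u v hu huv hv =>
      (hcont.mono (Icc_subset_Icc hu hv)).intervalIntegrable_of_Icc huv
    rw [length_eq_integral_speed, intervalIntegral.integral_add_adjacent_intervals
      (hi _ _ le_rfl ht₁.1 ht₁.2) (hi _ _ ht₁.1 h12 ht₂.2),
      intervalIntegral.integral_add_adjacent_intervals
      (hi _ _ le_rfl ht₂.1 ht₂.2) (hi _ _ ht₂.1 ht₂.2 le_rfl)]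
  have hI₀ : 0 ≤ ∫ t in t₁..t₂, speed (warp β a) c t :=
    intervalIntegral.integral_nonneg h12 fun t _ => speed_nonneg _ c t
  have hp₁ := push_mem ha θ₁ x
  have hp₂ := push_mem ha θ₁ y
  have hp₃ : point (r y) θ₁ φ₂ ∈ Sᶜ := point_mem_compl_S _ _ (sin_r_ne_zero hyS)
  have k₁ := dExtreme_triangle β hpS hxS hqS
  have k₂ := dExtreme_triangle β hxS hp₁ hqS
  have k₃ := dExtreme_triangle β hp₁ hp₂ hqS
  have k₄ := dExtreme_triangle β hp₂ hp₃ hqS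
  have k₅ := dExtreme_triangle β hp₃ hyS hqS
  rw [hint]
  nlinarith [mul_nonneg hε.le hI₀]

/-- Away from the singular set, the limit distance is the distance of the extreme limit metric. -/
lemma dLim_eq_dExtreme {β : ℝ} {a : ℕ → ℝ} (hβ : 1 ≤ β) (ha_pos : ∀ j, 0 < a j)
    (ha_lim : Tendsto a atTop (𝓝 0)) {p q : M} (hp : p ∈ Sᶜ) (hq : q ∈ Sᶜ) :
    dLim β a p q = riemannianDist (warpLimit β) Sᶜ p q := by
  refine le_antisymm
    (ciSup_le fun j => dWarp_le_dExtreme (zero_le_one.trans hβ) (ha_pos j) hp hq) ?_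
  have key : ∀ᶠ ε in 𝓝[>] (0 : ℝ), riemannianDist (warpLimit β) Sᶜ p q ≤
      (1 + ε) * dLim β a p q + (2 * ε + 2 * Real.pi * ε) := by
    have hsmall : ∀ w : M, w ∈ Sᶜ → ∀ᶠ ε in 𝓝[>] (0 : ℝ), ε < Real.sin (r w) := fun w hw =>
      nhdsWithin_le_nhds (Iio_mem_nhds (sin_r_pos hw))
    filter_upwards [hsmall p hp, hsmall q hq, self_mem_nhdsWithin] with ε h1 h2 hε
    obtain ⟨δ, hδ, h⟩ := exists_dExtreme_le_dWarp hβ hε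
      (pow_lt_pow_left₀ h1 (le_of_lt hε) two_ne_zero)
      (pow_lt_pow_left₀ h2 (le_of_lt hε) two_ne_zero)
    obtain ⟨j, hj⟩ := (ha_lim.eventually (Iio_mem_nhds hδ)).exists
    have h3 := h (a j) (ha_pos j) hj
    have h4 := dWarp_le_dLim hβ ha_pos j p q
    have hε' : 0 < ε := hε
    have h5 : (1 + ε) * dWarp β (a j) p q ≤ (1 + ε) * dLim β a p q := by gcongr
    linarith
  refine ge_of_tendsto ?_ key
  have : Continuous fun ε : ℝ => (1 + ε) * dLim β a p q + (2 * ε + 2 * Real.pi * ε) := by fun_prop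
  have h := (this.tendsto 0).mono_left (nhdsWithin_le_nhds (s := Ioi 0))
  simpa using h

lemma dense_compl_S : Dense (Sᶜ : Set M) := by
  intro p
  obtain ⟨θ, -, φ, -, hp⟩ := exists_polar p
  have hc' : Continuous fun ρ : ℝ => (ρ, θ, φ) := by fun_prop
  have hc := continuous_point.comp hc'
  have h : r p ∈ closure (Ioo 0 Real.pi) := (closure_Ioo Real.pi_pos.ne).ge (r_mem p)
  have h' := map_mem_closure (t := Sᶜ) hc h fun ρ hρ =>
    point_mem_compl_S θ φ (Real.sin_pos_of_pos_of_lt_pi hρ.1 hρ.2).ne'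
  rw [hp]
  exact h'

lemma isometry_dExtreme_dLim {β : ℝ} {a : ℕ → ℝ} (hβ : 1 ≤ β) (ha_pos : ∀ j, 0 < a j)
    (ha_lim : Tendsto a atTop (𝓝 0)) (hext : IsMetric (dExtreme β)) (h : IsMetric (dLim β a)) :
    Isometry fun p : Space hext => Space.of h (p.pt : M) :=
  Isometry.of_dist_eq fun p q => dLim_eq_dExtreme hβ ha_pos ha_lim p.pt.2 q.pt.2

lemma denseRange_inclusion {β : ℝ} {d : M → M → ℝ} (hd : HasPolarModulus β d) (h : IsMetric d)
    (hext : IsMetric (dExtreme β)) :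
    DenseRange fun p : Space hext => Space.of h (p.pt : M) := by
  have h1 : DenseRange (Subtype.val : (Sᶜ : Set M) → M) := by
    rw [DenseRange, Subtype.range_coe]
    exact dense_compl_S
  have h2 : DenseRange (Space.of h) := fun x => subset_closure ⟨x.pt, rfl⟩
  exact h2.comp h1 (hd.continuous_of h)

/-! ### Hausdorff measures and locally Lipschitz maps -/

section hausdorff

variable {X Y : Type*} [MetricSpace X] [MeasurableSpace X] [BorelSpace X]
  [MetricSpace Y] [MeasurableSpace Y] [BorelSpace Y]

/-- A map that is `K`-Lipschitz at small scales increases the Hausdorff measure at most by the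
factor `K ^ d`. -/
lemma hausdorffMeasure_image_le_of_small_scale [SecondCountableTopology X] {s : Set X}
    (hs : MeasurableSet s) {f : X → Y} {K : NNReal} {δ : ℝ} (hδ : 0 < δ)
    (hf : ∀ x ∈ s, ∀ y ∈ s, dist x y < δ → dist (f x) (f y) ≤ K * dist x y) {d : ℝ} (hd : 0 ≤ d) :
    Measure.hausdorffMeasure d (f '' s) ≤ (K : ENNReal) ^ d * Measure.hausdorffMeasure d s := by
  obtain ⟨A, hA, hb, hdiam, hU, hdisj⟩ :=
    SeparableSpace.exists_measurable_partition_diam_le X (half_pos hδ)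
  have hlip : ∀ n, LipschitzOnWith K f (s ∩ A n) := fun n =>
    LipschitzOnWith.of_dist_le_mul fun x hx y hy => hf x hx.1 y hy.1
      (((Metric.dist_le_diam_of_mem (hb n) hx.2 hy.2).trans (hdiam n)).trans_lt (half_lt_self hδ))
  have hsU : s = ⋃ n, s ∩ A n := by rw [← inter_iUnion, hU, inter_univ]
  calc Measure.hausdorffMeasure d (f '' s)
      = Measure.hausdorffMeasure d (⋃ n, f '' (s ∩ A n)) := by rw [← image_iUnion, ← hsU]
    _ ≤ ∑' n, Measure.hausdorffMeasure d (f '' (s ∩ A n)) := measure_iUnion_le _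
    _ ≤ ∑' n, (K : ENNReal) ^ d * Measure.hausdorffMeasure d (s ∩ A n) :=
        ENNReal.tsum_le_tsum fun n => (hlip n).hausdorffMeasure_image_le hd
    _ = (K : ENNReal) ^ d * Measure.hausdorffMeasure d s := by
        rw [ENNReal.tsum_mul_left, ← measure_iUnion
          (fun i j hij => (hdisj hij).mono inter_subset_right inter_subset_right)
          (fun n => hs.inter (hA n)), ← hsU]

/-- An injective map that contracts small distances at most by the factor `K` decreases the
Hausdorff measure at most by the factor `K ^ d`. -/
lemma hausdorffMeasure_le_image_of_small_scale [PolishSpace X] {s : Set X} (hs : MeasurableSet s)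
    {f : X → Y} (hfc : ContinuousOn f s) (hinj : InjOn f s) {K : NNReal} {δ : ℝ} (hδ : 0 < δ)
    (hf : ∀ x ∈ s, ∀ y ∈ s, dist x y < δ → dist x y ≤ K * dist (f x) (f y)) {d : ℝ} (hd : 0 ≤ d) :
    Measure.hausdorffMeasure d s ≤ (K : ENNReal) ^ d * Measure.hausdorffMeasure d (f '' s) := by
  rcases isEmpty_or_nonempty X with hX | hX
  · rw [s.eq_empty_of_isEmpty]; simp
  obtain ⟨A, hA, hb, hdiam, hU, hdisj⟩ :=
    SeparableSpace.exists_measurable_partition_diam_le X (half_pos hδ)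
  have hsU : s = ⋃ n, s ∩ A n := by rw [← inter_iUnion, hU, inter_univ]
  have hle : ∀ n, Measure.hausdorffMeasure d (s ∩ A n) ≤
      (K : ENNReal) ^ d * Measure.hausdorffMeasure d (f '' (s ∩ A n)) := by
    intro n
    have hlip : LipschitzOnWith K (Function.invFunOn f s) (f '' (s ∩ A n)) := by
      refine LipschitzOnWith.of_dist_le_mul ?_
      rintro _ ⟨x, hx, rfl⟩ _ ⟨y, hy, rfl⟩
      rw [hinj.leftInvOn_invFunOn hx.1, hinj.leftInvOn_invFunOn hy.1]
      exact hf x hx.1 y hy.1 (((Metric.dist_le_diam_of_mem (hb n) hx.2 hy.2).trans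
        (hdiam n)).trans_lt (half_lt_self hδ))
    have h := hlip.hausdorffMeasure_image_le hd
    rwa [hinj.invFunOn_image inter_subset_left] at h
  calc Measure.hausdorffMeasure d s = Measure.hausdorffMeasure d (⋃ n, s ∩ A n) := by rw [← hsU]
    _ ≤ ∑' n, Measure.hausdorffMeasure d (s ∩ A n) := measure_iUnion_le _
    _ ≤ ∑' n, (K : ENNReal) ^ d * Measure.hausdorffMeasure d (f '' (s ∩ A n)) :=
        ENNReal.tsum_le_tsum hle
    _ = (K : ENNReal) ^ d * Measure.hausdorffMeasure d (f '' s) := by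
        rw [ENNReal.tsum_mul_left, ← measure_iUnion, ← image_iUnion, ← hsU]
        · intro i j hij
          refine (disjoint_image_image fun x hx y hy hxy => ?_)
          exact (hdisj hij).ne_of_mem hx.2 hy.2 (hinj hx.1 hy.1 hxy)
        · exact fun n => (hs.inter (hA n)).image_of_continuousOn_injOn
            (hfc.mono inter_subset_left) (hinj.mono inter_subset_left)

lemma euclideanHausdorffMeasure_image_le_of_small_scale [SecondCountableTopology X] {s : Set X}
    (hs : MeasurableSet s) {f : X → Y} {K : NNReal} {δ : ℝ} (hδ : 0 < δ)
    (hf : ∀ x ∈ s, ∀ y ∈ s, dist x y < δ → dist (f x) (f y) ≤ K * dist x y) (d : ℕ) :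
    μHE[d] (f '' s) ≤ (K : ENNReal) ^ d * μHE[d] s := by
  have h := hausdorffMeasure_image_le_of_small_scale hs hδ hf (Nat.cast_nonneg d)
  rw [ENNReal.rpow_natCast] at h
  rw [Measure.euclideanHausdorffMeasure_def, Measure.euclideanHausdorffMeasure_def,
    Measure.smul_apply, Measure.smul_apply, ENNReal.smul_def, ENNReal.smul_def, smul_eq_mul,
    smul_eq_mul, mul_left_comm]
  gcongr

lemma euclideanHausdorffMeasure_le_image_of_small_scale [PolishSpace X] {s : Set X}
    (hs : MeasurableSet s) {f : X → Y} (hfc : ContinuousOn f s) (hinj : InjOn f s) {K : NNReal}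
    {δ : ℝ} (hδ : 0 < δ)
    (hf : ∀ x ∈ s, ∀ y ∈ s, dist x y < δ → dist x y ≤ K * dist (f x) (f y)) (d : ℕ) :
    μHE[d] s ≤ (K : ENNReal) ^ d * μHE[d] (f '' s) := by
  have h := hausdorffMeasure_le_image_of_small_scale hs hfc hinj hδ hf (Nat.cast_nonneg d)
  rw [ENNReal.rpow_natCast] at h
  rw [Measure.euclideanHausdorffMeasure_def, Measure.euclideanHausdorffMeasure_def,
    Measure.smul_apply, Measure.smul_apply, ENNReal.smul_def, ENNReal.smul_def, smul_eq_mul,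
    smul_eq_mul, mul_left_comm]
  gcongr

end hausdorff

/-! ### The singular fibres -/

section fibres

lemma point_of_sin_eq_zero {ρ : ℝ} (hρ : Real.sin ρ = 0) (θ θ' φ : ℝ) :
    point ρ θ φ = point ρ θ' φ := by
  simp [point, hρ]

lemma sin_eq_zero_of_mem_pair {ρ : ℝ} (hρ : ρ ∈ ({0, Real.pi} : Set ℝ)) : Real.sin ρ = 0 := by
  rcases hρ with rfl | rfl
  · exact Real.sin_zero
  · exact Real.sin_pi

lemma mem_Icc_of_mem_pair {ρ : ℝ} (hρ : ρ ∈ ({0, Real.pi} : Set ℝ)) : ρ ∈ Icc 0 Real.pi := by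
  rcases hρ with rfl | rfl
  · exact ⟨le_rfl, Real.pi_pos.le⟩
  · exact ⟨Real.pi_pos.le, le_rfl⟩

lemma fibre_eq_image_Ico {ρ : ℝ} (hρ : ρ ∈ ({0, Real.pi} : Set ℝ)) :
    fibre ρ = point ρ 0 '' Ico 0 (2 * Real.pi) := by
  ext p
  constructor
  · intro hp
    obtain ⟨θ, -, φ, hφ, h⟩ := exists_polar p
    rw [show r p = ρ from hp, point_of_sin_eq_zero (sin_eq_zero_of_mem_pair hρ) θ 0] at h
    exact ⟨φ, hφ, h.symm⟩
  · rintro ⟨φ, -, rfl⟩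
    exact r_point_of_mem (mem_Icc_of_mem_pair hρ) 0 φ

lemma eq_of_cos_sub_eq_one {x y : ℝ} (hx : x ∈ Ico 0 (2 * Real.pi)) (hy : y ∈ Ico 0 (2 * Real.pi))
    (h : Real.cos (x - y) = 1) : x = y :=
  sub_eq_zero.1 ((Real.cos_eq_one_iff_of_lt_of_lt (by linarith [hx.1, hy.2])
    (by linarith [hx.2, hy.1])).1 h)

lemma cos_sub_eq_one_of_point_eq {ρ θ φ ρ' θ' φ' : ℝ} (h : point ρ θ φ = point ρ' θ' φ') :
    Real.cos (φ - φ') = 1 := by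
  have := chord_circle_sq ρ θ φ ρ' θ' φ'
  rw [h] at this
  simp only [sub_self, norm_zero] at this
  linarith

variable {β : ℝ} {a : ℕ → ℝ} (hβ : 1 ≤ β) (ha_pos : ∀ j, 0 < a j)
  (ha_lim : Tendsto a atTop (𝓝 0))
include hβ ha_pos ha_lim

/-- The distance on a singular fibre grows faster than any multiple of the angle: near the fibre the
warping functions are large, and leaving that region takes a fixed length. -/
lemma exists_mul_le_dLim {ρ : ℝ} (hρ : ρ ∈ ({0, Real.pi} : Set ℝ)) {K : ℝ} (hK : 0 < K) :
    ∃ δ > 0, ∀ φ φ' : ℝ, |φ - φ'| < δ →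
      K * |φ - φ'| ≤ dLim β a (point ρ 0 φ) (point ρ 0 φ') := by
  have hpi := Real.pi_pos
  -- a chord of the circle is at least `2 / π` times the angle
  set N := K * (Real.pi / 2) with hN
  have hN0 : 0 < N := by positivity
  set E := Real.exp (-N) with hE
  have hE0 : 0 < E := Real.exp_pos _
  obtain ⟨j, hj⟩ := (ha_lim.eventually (Iio_mem_nhds (half_pos hE0))).exists
  have haj := ha_pos j
  refine ⟨min Real.pi (E / 4 / K), by positivity, fun φ φ' hlt => ?_⟩
  refine le_trans ?_ (dWarp_le_dLim hβ ha_pos j _ _)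
  have hcos : Real.cos ρ ^ 2 = 1 := by
    have := Real.sin_sq_add_cos_sq ρ
    rw [sin_eq_zero_of_mem_pair hρ] at this
    linarith
  -- the warping function is at least `N` where the height differs by less than `E / 4`
  have hbig : ∀ x ∈ (univ : Set M), |(x.1 : E3) 2 - ((point ρ 0 φ).1 : E3) 2| < E / 4 →
      N ≤ warp β (a j) (r x) := by
    intro x _ hx
    rw [point_height] at hx
    have h1 : 1 - (x.1 : E3) 2 ^ 2 ≤ E / 2 := by
      have hz := height_mem x.1
      have h2 : |Real.cos ρ + (x.1 : E3) 2| ≤ 2 := abs_le.2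
        ⟨by linarith [Real.neg_one_le_cos ρ, hz.1], by linarith [Real.cos_le_one ρ, hz.2]⟩
      calc 1 - (x.1 : E3) 2 ^ 2
          = -((x.1 : E3) 2 - Real.cos ρ) * (Real.cos ρ + (x.1 : E3) 2) := by
            linear_combination -hcos
        _ ≤ |-((x.1 : E3) 2 - Real.cos ρ) * (Real.cos ρ + (x.1 : E3) 2)| := le_abs_self _
        _ ≤ E / 4 * 2 := by rw [abs_mul, abs_neg]; gcongr
        _ = E / 2 := by ring
    have hx1 := height_sq_le x.1
    rw [warp, sin_r_sq]
    have h2 : N ≤ Real.log ((1 + a j) / (1 - (x.1 : E3) 2 ^ 2 + a j)) := by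
      rw [Real.le_log_iff_exp_le (by positivity), le_div_iff₀ (by linarith)]
      have h3 : Real.exp N * E = 1 := by rw [hE, ← Real.exp_add]; simp
      have hj' : a j < E / 2 := hj
      calc Real.exp N * (1 - (x.1 : E3) 2 ^ 2 + a j) ≤ Real.exp N * E := by
            gcongr; linarith
        _ ≤ 1 + a j := by linarith
    linarith
  have hmin := min_chord_le_riemannianDist (f := warp β (a j)) (q := point ρ 0 φ')
    (continuous_warp β haj).continuousOn (fun x _ => zero_le_one.trans (hβ.trans (le_warp β haj _)))
    (exists_isCurve_univ (point ρ 0 φ) _) hN0.le hbig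
  refine le_trans (le_min ?_ ?_) hmin
  · refine Real.le_sqrt_of_sq_le ?_
    have hcosφ : 4 / Real.pi ^ 2 * (φ - φ') ^ 2 ≤ 2 - 2 * Real.cos (φ' - φ) := by
      have h1 := Real.cos_le_one_sub_mul_cos_sq (hlt.le.trans (min_le_left _ _))
      rw [← neg_sub φ φ', Real.cos_neg]
      have h2 : 4 / Real.pi ^ 2 * (φ - φ') ^ 2 = 2 * (2 / Real.pi ^ 2 * (φ - φ') ^ 2) := by ring
      linarith
    rw [chord_circle_sq, chord_sphere_sq]
    simp only [sub_self, Real.cos_zero]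
    rw [mul_pow, sq_abs, hN]
    have : K ^ 2 * (φ - φ') ^ 2 = (K * (Real.pi / 2)) ^ 2 * (4 / Real.pi ^ 2 * (φ - φ') ^ 2) := by
      field_simp
      norm_num
    rw [this]
    nlinarith [sq_nonneg (K * (Real.pi / 2))]
  · have := hlt.le.trans (min_le_right _ _)
    rwa [le_div_iff₀ hK, mul_comm] at this

omit ha_lim in
lemma continuous_of_point (h : IsMetric (dLim β a)) :
    Continuous fun x : ℝ × ℝ × ℝ => Space.of h (point x.1 x.2.1 x.2.2) := by
  have := ((hasPolarModulus_dLim hβ ha_pos).continuous_of h).comp continuous_point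
  exact this

lemma hausdorffMeasure_fibre (h : IsMetric (dLim β a)) {ρ : ℝ}
    (hρ : ρ ∈ ({0, Real.pi} : Set ℝ)) :
    Measure.hausdorffMeasure 1 (Space.of h '' fibre ρ) = ⊤ := by
  have hpi := Real.pi_pos
  have hc' : Continuous fun φ : ℝ => (ρ, (0 : ℝ), φ) := by fun_prop
  have hc := (continuous_of_point hβ ha_pos h).comp hc'
  have hinj : InjOn (fun φ => Space.of h (point ρ 0 φ)) (Ico 0 (2 * Real.pi)) :=
    fun x hx y hy hxy => eq_of_cos_sub_eq_one hx hy
      (cos_sub_eq_one_of_point_eq (ρ := ρ) (ρ' := ρ) (θ := 0) (θ' := 0) hxy)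
  rw [fibre_eq_image_Ico hρ, image_image]
  refine ENNReal.eq_top_of_forall_nnreal_le fun k => ?_
  have hk : 0 < (k : ℝ) + 1 := by positivity
  obtain ⟨δ, hδ, hexp⟩ := exists_mul_le_dLim hβ ha_pos ha_lim hρ hk
  have hle := hausdorffMeasure_le_image_of_small_scale (d := 1) (K := (k + 1)⁻¹) measurableSet_Ico
    (Continuous.continuousOn hc) hinj hδ (fun x _ y _ hxy => by
      rw [Real.dist_eq] at hxy ⊢
      have := hexp x y hxy
      push_cast
      rw [inv_mul_eq_div, le_div_iff₀ hk, mul_comm]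
      exact this) zero_le_one
  rw [hausdorffMeasure_real, Real.volume_Ico, ENNReal.rpow_one, sub_zero] at hle
  have h1 : 1 ≤ ENNReal.ofReal (2 * Real.pi) :=
    ENNReal.one_le_ofReal.2 (by linarith [Real.pi_gt_three])
  calc (k : ENNReal) ≤ ((k + 1 : NNReal) : ENNReal) * ENNReal.ofReal (2 * Real.pi) :=
        le_mul_of_le_of_one_le (by exact_mod_cast le_self_add) h1
    _ ≤ ((k + 1 : NNReal) : ENNReal) * (((k + 1)⁻¹ : NNReal) * _) := by gcongr
    _ = _ := by
        rw [← mul_assoc, ← ENNReal.coe_mul, mul_inv_cancel₀ (by positivity), ENNReal.coe_one,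
          one_mul]
        rfl

lemma eVariationOn_fibre (h : IsMetric (dLim β a)) {ρ : ℝ}
    (hρ : ρ ∈ ({0, Real.pi} : Set ℝ)) :
    eVariationOn (fun t => Space.of h (point ρ 0 t)) (Icc 0 (2 * Real.pi)) = ⊤ := by
  have hpi := Real.pi_pos
  refine ENNReal.eq_top_of_forall_nnreal_le fun k => ?_
  have hk : 0 < (k : ℝ) + 1 := by positivity
  obtain ⟨δ, hδ, hexp⟩ := exists_mul_le_dLim hβ ha_pos ha_lim hρ hk
  obtain ⟨n, hn⟩ := exists_nat_gt (2 * Real.pi / δ)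
  have hn0 : 0 < (n : ℝ) := lt_of_le_of_lt (by positivity) hn
  set s := 2 * Real.pi / n with hs
  have hs0 : 0 < s := by positivity
  have hsδ : s < δ := by
    rw [div_lt_iff₀ hδ] at hn
    rw [hs, div_lt_iff₀ hn0]; linarith
  have hle := eVariationOn.sum_le_of_monotoneOn_Icc (f := fun t => Space.of h (point ρ 0 t))
    (s := Icc 0 (2 * Real.pi)) (m := 0) (n := n) (u := fun i => i * s)
    (fun i _ j _ hij => by
      have : (i : ℝ) ≤ j := by exact_mod_cast hij
      exact mul_le_mul_of_nonneg_right this hs0.le)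
    (fun i hi => ⟨by positivity, by
      have : (i : ℝ) ≤ n := by exact_mod_cast hi.2
      calc i * s ≤ n * s := by gcongr
        _ = 2 * Real.pi := by rw [hs]; field_simp⟩)
  refine le_trans ?_ hle
  have hterm : ∀ i ∈ Finset.Ico 0 n, ENNReal.ofReal (k * s) ≤
      edist (Space.of h (point ρ 0 (((i + 1 : ℕ) : ℝ) * s))) (Space.of h (point ρ 0 (i * s))) := by
    intro i _
    rw [edist_dist]
    refine ENNReal.ofReal_le_ofReal ?_
    have hd : |((i + 1 : ℕ) : ℝ) * s - i * s| = s := by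
      push_cast
      rw [add_mul, one_mul, add_sub_cancel_left, abs_of_pos hs0]
    have := hexp (((i + 1 : ℕ) : ℝ) * s) (i * s) (by rw [hd]; exact hsδ)
    rw [hd] at this
    refine le_trans ?_ this
    nlinarith
  refine le_trans ?_ (Finset.sum_le_sum hterm)
  rw [Finset.sum_const, Nat.card_Ico, tsub_zero, nsmul_eq_mul, ← ENNReal.ofReal_natCast,
    ← ENNReal.ofReal_mul hn0.le, ← ENNReal.ofReal_coe_nnreal]
  refine ENNReal.ofReal_le_ofReal ?_
  have : (n : ℝ) * (k * s) = k * (2 * Real.pi) := by rw [hs]; field_simp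
  rw [this]
  nlinarith [Real.pi_gt_three, k.2]

omit ha_lim in
/-- The parametrization of a singular fibre by the angle is Hölder continuous with any exponent less
than one: a rotation by a small angle may be performed at a distance from the fibre proportional to
the angle, where the warping function grows only logarithmically. -/
lemma exists_holderOnWith_fibre (h : IsMetric (dLim β a)) {ρ : ℝ}
    (hρ : ρ ∈ ({0, Real.pi} : Set ℝ)) {α : NNReal} (hα : α < 1) :
    ∃ C : NNReal, HolderOnWith C α (fun φ => Space.of h (point ρ 0 φ)) (Ico 0 (2 * Real.pi)) := by
  have hpi := Real.pi_pos
  have hα' : 0 < 1 - (α : ℝ) := sub_pos.2 (by exact_mod_cast hα)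
  let C : ℝ := Real.pi + 2 * Real.pi * (2 / (1 - α) + β)
  have hC : 0 ≤ C := by positivity
  have key : ∀ φ ∈ Ico 0 (2 * Real.pi), ∀ φ' ∈ Ico 0 (2 * Real.pi),
      dLim β a (point ρ 0 φ) (point ρ 0 φ') ≤ C * |φ - φ'| ^ (α : ℝ) := by
    intro φ hφ φ' hφ'
    rcases eq_or_ne φ φ' with rfl | hne
    · rw [h.dist_self]; positivity
    -- `y` is the fraction of the full circle between the two points
    set y := |φ - φ'| / (2 * Real.pi) with hy
    have hd0 : 0 < |φ - φ'| := abs_pos.2 (sub_ne_zero.2 hne)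
    have hy0 : 0 < y := by positivity
    have hy1 : y ≤ 1 := by
      rw [hy, div_le_one (by positivity)]
      exact abs_sub_le_iff.2 ⟨by linarith [hφ.2, hφ'.1], by linarith [hφ'.2, hφ.1]⟩
    have hdy : |φ - φ'| = 2 * Real.pi * y := by rw [hy]; field_simp
    have hmod := hasPolarModulus_dLim hβ ha_pos ρ (mem_Icc_of_mem_pair hρ) ρ
      (mem_Icc_of_mem_pair hρ) 0 0 φ φ' (Real.pi / 2 * y) ⟨by positivity, by nlinarith⟩
    rw [sub_self, sub_self, abs_zero, zero_add, zero_add, abs_sub_comm, hdy] at hmod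
    have hsin : y ≤ Real.sin (Real.pi / 2 * y) := by
      have := Real.mul_le_sin (x := Real.pi / 2 * y) (by positivity) (by nlinarith)
      calc y = 2 / Real.pi * (Real.pi / 2 * y) := by field_simp
        _ ≤ _ := this
    have hlog : Real.log (1 / Real.sin (Real.pi / 2 * y) ^ 2) ≤
        2 * (y⁻¹ ^ (1 - α : ℝ) / (1 - α)) := by
      have h1 : Real.log (1 / Real.sin (Real.pi / 2 * y) ^ 2) ≤ Real.log (y⁻¹ ^ 2) := by
        refine Real.log_le_log (by have := hy0.trans_le hsin; positivity) ?_
        rw [inv_pow, one_div]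
        gcongr
      have h2 := Real.log_le_rpow_div (x := y⁻¹) (by positivity) hα'
      rw [Real.log_pow] at h1
      push_cast at h1
      linarith
    have hyα : y * y⁻¹ ^ (1 - α : ℝ) = y ^ (α : ℝ) := by
      rw [Real.inv_rpow hy0.le, ← Real.rpow_neg hy0.le]
      nth_rewrite 1 [← Real.rpow_one y]
      rw [← Real.rpow_add hy0]
      ring_nf
    have hyle : y ≤ y ^ (α : ℝ) := by
      nth_rewrite 1 [← Real.rpow_one y]
      exact Real.rpow_le_rpow_of_exponent_ge hy0 hy1 (by exact_mod_cast hα.le)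
    have h3 : warpLimit β (Real.pi / 2 * y) * y ≤ (2 / (1 - α) + β) * y ^ (α : ℝ) := by
      calc warpLimit β (Real.pi / 2 * y) * y
          ≤ (2 * (y⁻¹ ^ (1 - α : ℝ) / (1 - α)) + β) * y := by
            rw [warpLimit]; gcongr
        _ = 2 / (1 - α) * (y * y⁻¹ ^ (1 - α : ℝ)) + β * y := by ring
        _ ≤ 2 / (1 - α) * y ^ (α : ℝ) + β * y ^ (α : ℝ) := by rw [hyα]; gcongr
        _ = _ := by ring
    have h4 : dLim β a (point ρ 0 φ) (point ρ 0 φ') ≤ C * y ^ (α : ℝ) := by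
      refine hmod.trans ?_
      have h5 : 2 * (Real.pi / 2 * y) ≤ Real.pi * y ^ (α : ℝ) := by nlinarith
      have h6 := mul_le_mul_of_nonneg_left h3 (by positivity : 0 ≤ 2 * Real.pi)
      have h7 : C * y ^ (α : ℝ) = Real.pi * y ^ (α : ℝ) +
          2 * Real.pi * ((2 / (1 - α) + β) * y ^ (α : ℝ)) := by simp only [C]; ring
      rw [h7]
      linarith
    refine h4.trans ?_
    gcongr
    rw [hy]
    exact div_le_self hd0.le (by linarith [Real.pi_gt_three])
  refine ⟨C.toNNReal, fun φ hφ φ' hφ' => ?_⟩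
  change _ ≤ ENNReal.ofReal C * _
  rw [edist_dist, edist_dist, ENNReal.ofReal_rpow_of_nonneg dist_nonneg α.coe_nonneg,
    ← ENNReal.ofReal_mul hC]
  exact ENNReal.ofReal_le_ofReal (key φ hφ φ' hφ')

omit ha_lim in
lemma dimH_fibre_le (h : IsMetric (dLim β a)) {ρ : ℝ}
    (hρ : ρ ∈ ({0, Real.pi} : Set ℝ)) : dimH (Space.of h '' fibre ρ) ≤ 1 := by
  by_contra! hlt
  obtain ⟨t, ht1, ht⟩ := ENNReal.lt_iff_exists_nnreal_btwn.1 hlt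
  have ht1 : 1 < t := by exact_mod_cast ht1
  have ht0 : 0 < t := zero_lt_one.trans ht1
  obtain ⟨C, hC⟩ := exists_holderOnWith_fibre hβ ha_pos h hρ (inv_lt_one_of_one_lt₀ ht1)
  have hle := hC.dimH_image_le (inv_pos.2 ht0)
  have h1 : dimH (Ico 0 (2 * Real.pi)) ≤ 1 := (dimH_mono (subset_univ _)).trans Real.dimH_univ.le
  rw [fibre_eq_image_Ico hρ, image_image] at ht
  refine absurd (ht.trans_le hle) (not_lt.2 ?_)
  rw [ENNReal.div_le_iff (by simpa using ht0.ne') (by simp), ENNReal.coe_inv ht0.ne',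
    ENNReal.mul_inv_cancel (by simpa using ht0.ne') (by simp)]
  exact h1

lemma dimH_S (h : IsMetric (dLim β a)) : dimH (Space.of h '' S) = 1 := by
  have h0 : (0 : ℝ) ∈ ({0, Real.pi} : Set ℝ) := by simp
  have hπ : Real.pi ∈ ({0, Real.pi} : Set ℝ) := by simp
  rw [S, image_union, dimH_union]
  refine le_antisymm (max_le (dimH_fibre_le hβ ha_pos h h0) (dimH_fibre_le hβ ha_pos h hπ))
    (le_max_of_le_left ?_)
  have := le_dimH_of_hausdorffMeasure_eq_top (d := 1) (s := Space.of h '' fibre 0)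
    (by exact_mod_cast hausdorffMeasure_fibre hβ ha_pos ha_lim h h0)
  simpa using this

lemma euclideanHausdorffMeasure_fibre (h : IsMetric (dLim β a)) {ρ : ℝ}
    (hρ : ρ ∈ ({0, Real.pi} : Set ℝ)) : μHE[1] (Space.of h '' fibre ρ) = ⊤ := by
  have htop : Measure.hausdorffMeasure ((1 : ℕ) : ℝ) (Space.of h '' fibre ρ) = ⊤ := by
    rw [Nat.cast_one]
    exact hausdorffMeasure_fibre hβ ha_pos ha_lim h hρ
  rw [Measure.euclideanHausdorffMeasure_def, Measure.smul_apply, htop, ENNReal.smul_def,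
    smul_eq_mul, ENNReal.mul_top]
  simpa using Measure.addHaarScalarFactor_volume_hausdorffMeasure_ne_zero 1

lemma euclideanHausdorffMeasure_S (h : IsMetric (dLim β a)) : μHE[1] (Space.of h '' S) = ⊤ :=
  top_le_iff.1 ((euclideanHausdorffMeasure_fibre hβ ha_pos ha_lim h (by simp)).ge.trans
    (measure_mono (image_mono subset_union_left)))

end fibres

/-! ### Measures on the line with a continuous density -/

/-- A measure on the line whose values on small intervals around `x` are comparable with `w x` times
the length is given by the increments of a primitive `W` of `w`. -/
lemma measure_Ioc_eq_of_local_density {μ : Measure ℝ} {w W : ℝ → ℝ} {a b : ℝ}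
    (hW : ∀ x ∈ Ioo a b, HasDerivAt W (w x) x)
    (hw : ∀ x ∈ Ioo a b, 0 ≤ w x)
    (hμ : ∀ x ∈ Ioo a b, ∀ ε > 0, ∃ δ > 0, ∀ s t, x - δ < s → s < t → t < x + δ →
      ENNReal.ofReal ((w x - ε) * (t - s)) ≤ μ (Ioc s t) ∧
        μ (Ioc s t) ≤ ENNReal.ofReal ((w x + ε) * (t - s)))
    {A B : ℝ} (hA : a < A) (hAB : A < B) (hB : B < b) :
    μ (Ioc A B) = ENNReal.ofReal (W B - W A) := by
  obtain ⟨A', haA', hA'A⟩ := exists_between hA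
  obtain ⟨B', hBB', hB'b⟩ := exists_between hB
  have hfin : μ (Icc A' B') < ⊤ := by
    refine isCompact_Icc.measure_lt_top_of_nhdsWithin fun x hx => ?_
    obtain ⟨δ, hδ, h⟩ := hμ x ⟨haA'.trans_le hx.1, hx.2.trans_lt hB'b⟩ 1 one_pos
    refine ⟨Ioc (x - δ / 2) (x + δ / 2), mem_nhdsWithin_of_mem_nhds
      (Ioc_mem_nhds (by linarith) (by linarith)), ?_⟩
    exact (h _ _ (by linarith) (by linarith) (by linarith)).2.trans_lt ENNReal.ofReal_lt_top
  have hne : ∀ {s t : ℝ}, A' ≤ s → t ≤ B' → μ (Ioc s t) ≠ ⊤ := fun hs ht =>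
    ((measure_mono (Ioc_subset_Icc_self.trans (Icc_subset_Icc hs ht))).trans_lt hfin).ne
  let H : ℝ → ℝ := fun t => (μ (Ioc A' t)).toReal
  have hsub : ∀ {s t : ℝ}, A' ≤ s → s ≤ t → t ≤ B' → H t - H s = (μ (Ioc s t)).toReal := by
    intro s t hs hst ht
    have : μ (Ioc A' t) = μ (Ioc A' s) + μ (Ioc s t) := by
      rw [← Ioc_union_Ioc_eq_Ioc hs hst,
        measure_union (Ioc_disjoint_Ioc_of_le le_rfl) measurableSet_Ioc]
    simp only [H]
    rw [this, ENNReal.toReal_add (hne le_rfl (hst.trans ht)) (hne hs ht), add_sub_cancel_left]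
  have hderiv : ∀ x ∈ Icc A B, HasDerivAt H (w x) x := by
    intro x hx
    have hxab : x ∈ Ioo a b := ⟨hA.trans_le hx.1, hx.2.trans_lt hB⟩
    rw [hasDerivAt_iff_isLittleO, Asymptotics.isLittleO_iff]
    intro ε hε
    obtain ⟨δ, hδ, h⟩ := hμ x hxab ε hε
    have hbound : ∀ s t, x - δ < s → s < t → t < x + δ → A' ≤ s → t ≤ B' →
        |H t - H s - (t - s) * w x| ≤ ε * (t - s) := by
      intro s t hs hst ht hs' ht'
      obtain ⟨h1, h2⟩ := h s t hs hst ht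
      rw [hsub hs' hst.le ht']
      have h1' := (ENNReal.ofReal_le_iff_le_toReal (hne hs' ht')).1 h1
      have h0 : 0 ≤ (w x + ε) * (t - s) :=
        mul_nonneg (add_nonneg (hw x hxab) hε.le) (sub_nonneg.2 hst.le)
      have h2' := ENNReal.toReal_le_of_le_ofReal h0 h2
      rw [abs_le]
      constructor <;> nlinarith
    filter_upwards [Ioo_mem_nhds (show x - δ < x by linarith) (show x < x + δ by linarith),
      Ioo_mem_nhds (hA'A.trans_le hx.1) (hx.2.trans_lt hBB')] with y hy hy'
    rw [smul_eq_mul, Real.norm_eq_abs, Real.norm_eq_abs]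
    rcases lt_trichotomy x y with hxy | rfl | hxy
    · rw [abs_of_pos (sub_pos.2 hxy)]
      exact hbound x y (by linarith) hxy hy.2 (hA'A.le.trans hx.1) hy'.2.le
    · simp
    · rw [abs_of_neg (sub_neg.2 hxy), ← abs_neg]
      have := hbound y x hy.1 hxy (by linarith) hy'.1.le (hx.2.trans hBB'.le)
      convert this using 2 <;> ring
  have hconst := constant_of_has_deriv_right_zero (f := fun x => H x - W x) (a := A) (b := B)
    (fun x hx => ((hderiv x hx).sub (hW x ⟨hA.trans_le hx.1,
      hx.2.trans_lt hB⟩)).continuousAt.continuousWithinAt)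
    (fun x hx => by
      have := (hderiv x (Ico_subset_Icc_self hx)).sub (hW x ⟨hA.trans_le hx.1, hx.2.trans hB⟩)
      rw [sub_self] at this
      exact this.hasDerivWithinAt) B ⟨hAB.le, le_rfl⟩
  have hAB' := hsub hA'A.le hAB.le hBB'.le
  rw [← ENNReal.ofReal_toReal (hne hA'A.le hBB'.le), ← hAB']
  congr 1
  linarith

lemma measure_Ioo_eq_of_local_density {μ : Measure ℝ} {w W : ℝ → ℝ} {a b : ℝ} (hab : a < b)
    (hW : ∀ x ∈ Ioo a b, HasDerivAt W (w x) x) (hWc : Continuous W)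
    (hw : ∀ x ∈ Ioo a b, 0 ≤ w x)
    (hμ : ∀ x ∈ Ioo a b, ∀ ε > 0, ∃ δ > 0, ∀ s t, x - δ < s → s < t → t < x + δ →
      ENNReal.ofReal ((w x - ε) * (t - s)) ≤ μ (Ioc s t) ∧
        μ (Ioc s t) ≤ ENNReal.ofReal ((w x + ε) * (t - s))) :
    μ (Ioo a b) = ENNReal.ofReal (W b - W a) := by
  obtain ⟨c, hac, hcb⟩ := exists_between hab
  obtain ⟨u, hu, hu', hul⟩ := exists_seq_strictAnti_tendsto' hac
  obtain ⟨v, hv, hv', hvl⟩ := exists_seq_strictMono_tendsto' hcb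
  have hU : ⋃ n, Ioc (u n) (v n) = Ioo a b := by
    ext x
    simp only [mem_iUnion, mem_Ioc, mem_Ioo]
    constructor
    · rintro ⟨n, h1, h2⟩
      exact ⟨(hu' n).1.trans h1, h2.trans_lt (hv' n).2⟩
    · rintro ⟨h1, h2⟩
      obtain ⟨n, h3, h4⟩ := ((hul.eventually (Iio_mem_nhds h1)).and
        (hvl.eventually (Ioi_mem_nhds h2))).exists
      exact ⟨n, h3, le_of_lt h4⟩
  have hmono : Monotone fun n => Ioc (u n) (v n) := fun m n hmn =>
    Ioc_subset_Ioc (hu.antitone hmn) (hv.monotone hmn)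
  have h1 := tendsto_measure_iUnion_atTop (μ := μ) hmono
  rw [hU] at h1
  refine tendsto_nhds_unique h1 ?_
  have h2 : ∀ n, μ (Ioc (u n) (v n)) = ENNReal.ofReal (W (v n) - W (u n)) := fun n =>
    measure_Ioc_eq_of_local_density hW hw hμ (hu' n).1 ((hu' n).2.trans (hv' n).1) (hv' n).2
  simp only [Function.comp_def, h2]
  exact ENNReal.tendsto_ofReal ((hWc.continuousAt.tendsto.comp hvl).sub
    (hWc.continuousAt.tendsto.comp hul))

/-! ### The volume -/

/-- The area element `(2π)² sin r · f_∞(r)` of the level sets of `r`. -/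
def levelArea (β ρ : ℝ) : ℝ := (2 * Real.pi) ^ 2 * (Real.sin ρ * warpLimit β ρ)

/-- A primitive of `levelArea` that is continuous up to the poles. -/
def levelAreaPrimitive (β ρ : ℝ) : ℝ :=
  (2 * Real.pi) ^ 2 * (Real.negMulLog (1 - Real.cos ρ) - Real.negMulLog (1 + Real.cos ρ) -
    (2 + β) * Real.cos ρ)

lemma hasDerivAt_levelAreaPrimitive (β : ℝ) {ρ : ℝ} (hρ : Real.sin ρ ≠ 0) :
    HasDerivAt (levelAreaPrimitive β) (levelArea β ρ) ρ := by
  have hsq := Real.sin_sq_add_cos_sq ρ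
  have h0 : 0 < Real.sin ρ ^ 2 := by positivity
  have h1 : 1 - Real.cos ρ ≠ 0 := fun h => by nlinarith
  have h2 : 1 + Real.cos ρ ≠ 0 := fun h => by nlinarith
  have hd1 := (Real.hasDerivAt_negMulLog h1).comp ρ ((Real.hasDerivAt_cos ρ).const_sub 1)
  have hd2 := (Real.hasDerivAt_negMulLog h2).comp ρ ((Real.hasDerivAt_cos ρ).const_add 1)
  have hd := ((hd1.sub hd2).sub ((Real.hasDerivAt_cos ρ).const_mul (2 + β))).const_mul
    ((2 * Real.pi) ^ 2)
  refine hd.congr_deriv ?_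
  have hlog : Real.log (1 / Real.sin ρ ^ 2) =
      -(Real.log (1 - Real.cos ρ) + Real.log (1 + Real.cos ρ)) := by
    rw [← Real.log_mul h1 h2, one_div, Real.log_inv]
    congr 2
    linarith
  rw [levelArea, warpLimit, hlog]
  ring

lemma continuous_levelAreaPrimitive (β : ℝ) : Continuous (levelAreaPrimitive β) := by
  unfold levelAreaPrimitive
  fun_prop

lemma levelAreaPrimitive_sub (β : ℝ) : levelAreaPrimitive β Real.pi - levelAreaPrimitive β 0 =
    (2 * Real.pi) ^ 2 * (2 * β + 4 - 2 * Real.log 4) := by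
  have h4 : Real.log 4 = 2 * Real.log 2 := by
    rw [show (4 : ℝ) = 2 ^ 2 by norm_num, Real.log_pow]; push_cast; ring
  rw [levelAreaPrimitive, levelAreaPrimitive, Real.cos_pi, Real.cos_zero, h4]
  norm_num [Real.negMulLog]
  ring

/-- `x ↦ 2 - 2 cos x` is the square of the chord of length `2 sin (x / 2)`. -/
lemma exists_sq_le_two_sub_cos {κ : ℝ} (hκ : 1 < κ) :
    ∃ τ > 0, ∀ x : ℝ, |x| < τ → x ^ 2 ≤ κ ^ 2 * (2 - 2 * Real.cos x) := by
  have hκ2 : 0 < 1 - (κ ^ 2)⁻¹ := sub_pos.2 (inv_lt_one_of_one_lt₀ (by nlinarith))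
  refine ⟨Real.sqrt (1 - (κ ^ 2)⁻¹), by positivity, fun x hx => ?_⟩
  have hx2 : x ^ 2 < 1 - (κ ^ 2)⁻¹ := by
    rw [← sq_abs]; exact (Real.lt_sqrt (abs_nonneg x)).1 hx
  have hi : 0 < (κ ^ 2)⁻¹ := by positivity
  have hb := (abs_le.1 (Real.cos_bound (x := x) (by
    rw [← sq_le_one_iff_abs_le_one]; linarith))).2
  have h4 : |x| ^ 4 = x ^ 2 * x ^ 2 := by
    rw [← sq_abs]; ring
  rw [h4] at hb
  have h5 : x ^ 2 * (κ ^ 2)⁻¹ ≤ 2 - 2 * Real.cos x := by nlinarith [sq_nonneg x]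
  calc x ^ 2 = κ ^ 2 * (x ^ 2 * (κ ^ 2)⁻¹) := by field_simp
    _ ≤ _ := by gcongr

/-- The coordinates `(r, σ θ, F φ)`, scaled such that they are almost isometric near a level set of
`r` where `sin r = σ` and the warping function takes the value `F`. -/
def chart (σ F : ℝ) (x : E3) : M := point (x 0) (x 1 / σ) (x 2 / F)

/-- The domain of the scaled coordinates over the interval `(s, t]`. -/
def chartBox (σ F s t : ℝ) : Set E3 :=
  {x | x 0 ∈ Ioc s t ∧ x 1 ∈ Ico 0 (2 * Real.pi * σ) ∧ x 2 ∈ Ico 0 (2 * Real.pi * F)}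

lemma chartBox_eq_preimage (σ F s t : ℝ) : chartBox σ F s t = WithLp.ofLp ⁻¹'
    univ.pi ![Ioc s t, Ico 0 (2 * Real.pi * σ), Ico 0 (2 * Real.pi * F)] := by
  ext x
  simp [chartBox, Fin.forall_fin_succ]

lemma measurableSet_pi_chartBox (σ F s t : ℝ) : MeasurableSet
    (univ.pi ![Ioc s t, Ico 0 (2 * Real.pi * σ), Ico 0 (2 * Real.pi * F)] : Set (Fin 3 → ℝ)) := by
  refine MeasurableSet.univ_pi fun i => ?_
  fin_cases i
  · exact measurableSet_Ioc
  · exact measurableSet_Ico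
  · exact measurableSet_Ico

lemma measurableSet_chartBox (σ F s t : ℝ) : MeasurableSet (chartBox σ F s t) := by
  rw [chartBox_eq_preimage]
  exact (PiLp.volume_preserving_ofLp (Fin 3)).measurable (measurableSet_pi_chartBox σ F s t)

lemma volume_chartBox {σ : ℝ} (hσ : 0 < σ) (F : ℝ) {s t : ℝ} (hst : s ≤ t) :
    volume (chartBox σ F s t) = ENNReal.ofReal ((2 * Real.pi) ^ 2 * (σ * F) * (t - s)) := by
  rw [chartBox_eq_preimage, (PiLp.volume_preserving_ofLp (Fin 3)).measure_preimage
    (measurableSet_pi_chartBox σ F s t).nullMeasurableSet, volume_pi_pi, Fin.prod_univ_three]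
  simp only [Matrix.cons_val, Real.volume_Ioc, Real.volume_Ico, sub_zero]
  have hpi := Real.pi_pos
  have hts := sub_nonneg.2 hst
  rw [← ENNReal.ofReal_mul (by linarith), ← ENNReal.ofReal_mul (by positivity)]
  congr 1
  ring

lemma chart_image {σ F s t : ℝ} (hσ : 0 < σ) (hF : 0 < F) (hs : 0 ≤ s) (ht : t ≤ Real.pi) :
    chart σ F '' chartBox σ F s t = {p | r p ∈ Ioc s t} := by
  ext p
  constructor
  · rintro ⟨x, ⟨h0, -, -⟩, rfl⟩
    rw [mem_ofPred_eq, chart, r_point_of_mem ⟨hs.trans h0.1.le, h0.2.trans ht⟩]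
    exact h0
  · intro hp
    obtain ⟨θ, hθ, φ, hφ, h⟩ := exists_polar p
    refine ⟨!₂[r p, σ * θ, F * φ], ⟨hp, ⟨mul_nonneg hσ.le hθ.1, ?_⟩,
      ⟨mul_nonneg hF.le hφ.1, ?_⟩⟩, ?_⟩
    · have := hθ.2
      simp only [Matrix.cons_val]
      nlinarith
    · have := hφ.2
      simp only [Matrix.cons_val]
      nlinarith
    · simp only [chart, Matrix.cons_val, mul_div_cancel_left₀ _ hσ.ne',
        mul_div_cancel_left₀ _ hF.ne']
      exact h.symm

lemma injOn_chart {σ F s t : ℝ} (hσ : 0 < σ) (hF : 0 < F) (hs : 0 ≤ s) (ht : t < Real.pi) :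
    InjOn (chart σ F) (chartBox σ F s t) := by
  rintro x ⟨hx0, hx1, hx2⟩ y ⟨hy0, hy1, hy2⟩ hxy
  have hdiv : ∀ {u c : ℝ}, 0 < c → u ∈ Ico 0 (2 * Real.pi * c) → u / c ∈ Ico 0 (2 * Real.pi) :=
    fun hc hu => ⟨div_nonneg hu.1 hc.le, (div_lt_iff₀ hc).2 hu.2⟩
  have h0 : x 0 = y 0 := by
    have := congrArg r hxy
    rwa [chart, chart, r_point_of_mem ⟨hs.trans hx0.1.le, hx0.2.trans ht.le⟩,
      r_point_of_mem ⟨hs.trans hy0.1.le, hy0.2.trans ht.le⟩] at this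
  have h2 : x 2 / F = y 2 / F :=
    eq_of_cos_sub_eq_one (hdiv hF hx2) (hdiv hF hy2) (cos_sub_eq_one_of_point_eq hxy)
  have h1 : x 1 / σ = y 1 / σ := by
    refine eq_of_cos_sub_eq_one (hdiv hσ hx1) (hdiv hσ hy1) ?_
    have hch := chord_sphere_sq (x 0) (x 1 / σ) (x 2 / F) (y 0) (y 1 / σ) (y 2 / F)
    rw [show point (x 0) (x 1 / σ) (x 2 / F) = point (y 0) (y 1 / σ) (y 2 / F) from hxy, h0] at hch
    simp only [sub_self, norm_zero, Real.cos_zero] at hch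
    have hsin : 0 < Real.sin (y 0) :=
      Real.sin_pos_of_pos_of_lt_pi (hs.trans_lt hy0.1) (hy0.2.trans_lt ht)
    have hss := mul_pos hsin hsin
    have : Real.sin (y 0) * Real.sin (y 0) * (2 - 2 * Real.cos (x 1 / σ - y 1 / σ)) = 0 := by
      linarith
    rcases mul_eq_zero.1 this with h | h
    · exact absurd h hss.ne'
    · linarith
  rw [div_left_inj' hσ.ne'] at h1
  rw [div_left_inj' hF.ne'] at h2
  ext i
  fin_cases i
  · exact h0
  · exact h1
  · exact h2

section volume

lemma continuousAt_warpLimit (β : ℝ) {ρ : ℝ} (hρ : Real.sin ρ ≠ 0) :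
    ContinuousAt (warpLimit β) ρ := by
  have h2 : Real.sin ρ ^ 2 ≠ 0 := pow_ne_zero 2 hρ
  unfold warpLimit
  exact ((continuousAt_const.div (Real.continuous_sin.continuousAt.pow 2) h2).log
    (one_div_ne_zero h2)).add continuousAt_const

variable {β : ℝ} {a : ℕ → ℝ} (hβ : 1 ≤ β) (ha_pos : ∀ j, 0 < a j)
  (ha_lim : Tendsto a atTop (𝓝 0))
include hβ ha_pos ha_lim

/-- Near a level set of `r`, the scaled coordinates are almost isometric at small scales. -/
lemma exists_chart_bilipschitz {ρ₀ : ℝ} (hρ₀ : ρ₀ ∈ Ioo 0 Real.pi) {κ : ℝ} (hκ : 1 < κ) :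
    ∃ δ > 0, Ioo (ρ₀ - δ) (ρ₀ + δ) ⊆ Ioo 0 Real.pi ∧ ∃ δ' > 0, ∀ x y : E3,
      x 0 ∈ Ioo (ρ₀ - δ) (ρ₀ + δ) → y 0 ∈ Ioo (ρ₀ - δ) (ρ₀ + δ) →
      let d := dLim β a (chart (Real.sin ρ₀) (warpLimit β ρ₀) x)
        (chart (Real.sin ρ₀) (warpLimit β ρ₀) y)
      d ≤ κ * dist x y ∧ (dist x y < δ' → dist x y ≤ κ ^ 2 * d) := by
  set σ := Real.sin ρ₀ with hσ
  set F := warpLimit β ρ₀ with hF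
  have hσ0 : 0 < σ := Real.sin_pos_of_pos_of_lt_pi hρ₀.1 hρ₀.2
  have hF0 : 0 < F := zero_lt_one.trans_le (hβ.trans (le_warpLimit β ρ₀))
  have hκ0 : 0 < κ := zero_lt_one.trans hκ
  have hev : ∀ᶠ ρ in 𝓝 ρ₀, ρ ∈ Ioo 0 Real.pi ∧ (σ / κ < Real.sin ρ ∧ Real.sin ρ < κ * σ) ∧
      (F / κ < warpLimit β ρ ∧ warpLimit β ρ < κ * F) := by
    have h1 : ∀ {c : ℝ}, 0 < c → Ioo (c / κ) (κ * c) ∈ 𝓝 c := fun hc =>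
      Ioo_mem_nhds (div_lt_self hc hκ) (by nlinarith)
    exact (isOpen_Ioo.eventually_mem hρ₀).and ((Real.continuous_sin.continuousAt.eventually_mem
      (h1 hσ0)).and ((continuousAt_warpLimit β hσ0.ne').eventually_mem (h1 hF0)))
  obtain ⟨δ₀, hδ₀, hnear⟩ := Metric.eventually_nhds_iff.1 hev
  have hnear : ∀ ρ ∈ Ioo (ρ₀ - δ₀) (ρ₀ + δ₀), ρ ∈ Ioo 0 Real.pi ∧
      (σ / κ < Real.sin ρ ∧ Real.sin ρ < κ * σ) ∧
      (F / κ < warpLimit β ρ ∧ warpLimit β ρ < κ * F) := fun ρ hρ => hnear (by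
    rw [Real.dist_eq, abs_lt]; exact ⟨by linarith [hρ.1], by linarith [hρ.2]⟩)
  have hhalf : Ioo (ρ₀ - δ₀ / 2) (ρ₀ + δ₀ / 2) ⊆ Ioo (ρ₀ - δ₀) (ρ₀ + δ₀) :=
    Ioo_subset_Ioo (by linarith) (by linarith)
  obtain ⟨η, hη, hunif⟩ := Metric.uniformContinuousOn_iff.1
    (isCompact_Icc.uniformContinuousOn_of_continuous
      (Real.continuous_arccos.continuousOn (s := Icc (-1 : ℝ) 1))) (δ₀ / 2) (half_pos hδ₀)
  obtain ⟨τ, hτ, hcos⟩ := exists_sq_le_two_sub_cos hκ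
  refine ⟨δ₀ / 2, half_pos hδ₀, fun ρ hρ => (hnear ρ (hhalf hρ)).1,
    min η (min τ (min (τ * σ) (τ * F))), by positivity, fun x y hx hy => ?_⟩
  have hxS : chart σ F x ∈ Sᶜ := point_mem_compl_S _ _
    (lt_trans (div_pos hσ0 hκ0) (hnear _ (hhalf hx)).2.1.1).ne'
  have hyS : chart σ F y ∈ Sᶜ := point_mem_compl_S _ _
    (lt_trans (div_pos hσ0 hκ0) (hnear _ (hhalf hy)).2.1.1).ne'
  intro d
  have hd : d = riemannianDist (warpLimit β) Sᶜ (chart σ F x) (chart σ F y) :=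
    dLim_eq_dExtreme hβ ha_pos ha_lim hxS hyS
  have hdist : dist x y = Real.sqrt ((y 0 - x 0) ^ 2 + (y 1 - x 1) ^ 2 + (y 2 - x 2) ^ 2) := by
    rw [dist_comm, EuclideanSpace.dist_eq, Fin.sum_univ_three]
    simp only [Real.dist_eq, sq_abs]
  have hcoord : ∀ i, |y i - x i| ≤ dist x y := fun i => by
    rw [dist_comm, dist_eq_norm, ← Real.norm_eq_abs, ← PiLp.sub_apply]
    exact PiLp.norm_apply_le _ i
  constructor
  · have huI : ∀ ρ ∈ uIcc (x 0) (y 0), ρ ∈ Ioo (ρ₀ - δ₀) (ρ₀ + δ₀) := fun ρ hρ =>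
      hhalf (ordConnected_Ioo.uIcc_subset hx hy hρ)
    have hle := riemannianDist_point_le (f := warpLimit β) (U := Sᶜ) (ρ₀ := x 0) (ρ₁ := y 0)
      (θ₀ := x 1 / σ) (θ₁ := y 1 / σ) (φ₀ := x 2 / F) (φ₁ := y 2 / F)
      (B := κ * |y 1 - x 1|) (C := κ * |y 2 - x 2|)
      (fun ρ hρ θ φ => point_mem_compl_S θ φ
        (lt_trans (div_pos hσ0 hκ0) (hnear ρ (huI ρ hρ)).2.1.1).ne')
      (fun ρ hρ => by
        obtain ⟨-, ⟨h1, h2⟩, -⟩ := hnear ρ (huI ρ hρ)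
        have h0 : 0 < Real.sin ρ := lt_trans (div_pos hσ0 hκ0) h1
        rw [← sub_div, abs_mul, abs_div, abs_of_pos h0, abs_of_pos hσ0, ← mul_div_assoc,
          div_le_iff₀ hσ0, mul_right_comm]
        gcongr)
      (fun ρ hρ => by
        obtain ⟨hρ', -, ⟨h1, h2⟩⟩ := hnear ρ (huI ρ hρ)
        have h0 : 0 < warpLimit β ρ := lt_trans (div_pos hF0 hκ0) h1
        rw [Real.arccos_cos hρ'.1.le hρ'.2.le, ← sub_div, abs_mul, abs_div, abs_of_pos h0,
          abs_of_pos hF0, ← mul_div_assoc, div_le_iff₀ hF0, mul_right_comm]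
        gcongr)
    rw [hd]
    refine hle.trans ?_
    have hdist2 : dist x y ^ 2 = (y 0 - x 0) ^ 2 + (y 1 - x 1) ^ 2 + (y 2 - x 2) ^ 2 := by
      rw [hdist, Real.sq_sqrt (by positivity)]
    rw [Real.sqrt_le_left (by positivity), mul_pow κ (dist x y), hdist2, mul_pow, mul_pow, sq_abs,
      sq_abs]
    nlinarith [mul_nonneg (sub_nonneg.2 (one_le_pow₀ hκ.le : 1 ≤ κ ^ 2)) (sq_nonneg (y 0 - x 0))]
  · intro hsmall
    have hs1 := hsmall.trans_le (min_le_left _ _)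
    have hs2 := (hsmall.trans_le (min_le_right _ _)).trans_le (min_le_left _ _)
    have hs3 := ((hsmall.trans_le (min_le_right _ _)).trans_le (min_le_right _ _)).trans_le
      (min_le_left _ _)
    have hs4 := ((hsmall.trans_le (min_le_right _ _)).trans_le (min_le_right _ _)).trans_le
      (min_le_right _ _)
    have hmin := min_chord_le_riemannianDist (f := warpLimit β) (U := Sᶜ) (p := chart σ F x)
      (q := chart σ F y) (m := F / κ) (η := η) (continuousOn_warpLimit β)
      (fun w _ => zero_le_one.trans (hβ.trans (le_warpLimit β _)))
      (exists_isCurve_compl_S hxS hyS) (by positivity) (fun w hw hwx => by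
        refine (hnear _ ?_).2.2.1.le
        have hxI := (hnear _ (hhalf hx)).1
        have h1 := hunif _ (height_mem w.1) _ (height_mem (chart σ F x).1) hwx
        have h2 : Real.arccos (((chart σ F x).1 : E3) 2) = x 0 :=
          Real.arccos_cos hxI.1.le hxI.2.le
        rw [h2, Real.dist_eq, abs_lt] at h1
        change Real.arccos _ ∈ _
        exact ⟨by linarith [hx.1, h1.1], by linarith [hx.2, h1.2]⟩)
    rw [← hd] at hmin
    have hfin : dist x y ≤ κ ^ 2 * min (Real.sqrt
        (‖((chart σ F y).1 : E3) - (chart σ F x).1‖ ^ 2 +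
          (F / κ) ^ 2 * ‖((chart σ F y).2 : ℂ) - (chart σ F x).2‖ ^ 2)) η := by
      rw [mul_min_of_nonneg _ _ (sq_nonneg κ)]
      refine le_min ?_ ?_
      · rw [chart, chart, chord_sphere_sq, chord_circle_sq, hdist, ← Real.sqrt_sq (sq_nonneg κ),
          ← Real.sqrt_mul (sq_nonneg _)]
        refine Real.sqrt_le_sqrt ?_
        have hdivlt : ∀ {u c : ℝ}, 0 < c → |u| < τ * c → |u / c| < τ := fun hc hu => by
          rwa [abs_div, abs_of_pos hc, div_lt_iff₀ hc]
        have h0 := hcos _ ((hcoord 0).trans_lt hs2)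
        have h1 := hcos _ (hdivlt hσ0 ((hcoord 1).trans_lt hs3))
        have h2 := hcos _ (hdivlt hF0 ((hcoord 2).trans_lt hs4))
        rw [← sub_div, ← sub_div]
        have hc : ∀ u : ℝ, 0 ≤ 2 - 2 * Real.cos u := fun u => by linarith [Real.cos_le_one u]
        have e0 : (y 0 - x 0) ^ 2 ≤ (κ ^ 2) ^ 2 * (2 - 2 * Real.cos (y 0 - x 0)) := by
          refine h0.trans (mul_le_mul_of_nonneg_right ?_ (hc _))
          exact le_self_pow₀ (one_le_pow₀ hκ.le) two_ne_zero
        have e1 : (y 1 - x 1) ^ 2 ≤ (κ ^ 2) ^ 2 * (Real.sin (y 0) * Real.sin (x 0) *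
            (2 - 2 * Real.cos ((y 1 - x 1) / σ))) := by
          have hy1 := (hnear _ (hhalf hy)).2.1.1
          have hx1 := (hnear _ (hhalf hx)).2.1.1
          have hss := mul_le_mul hy1.le hx1.le (by positivity)
            ((by positivity : 0 ≤ σ / κ).trans hy1.le)
          calc (y 1 - x 1) ^ 2 = σ ^ 2 * ((y 1 - x 1) / σ) ^ 2 := by field_simp
            _ ≤ σ ^ 2 * (κ ^ 2 * (2 - 2 * Real.cos ((y 1 - x 1) / σ))) := by gcongr
            _ = (κ ^ 2) ^ 2 * (σ / κ * (σ / κ) * (2 - 2 * Real.cos ((y 1 - x 1) / σ))) := by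
              field_simp
            _ ≤ _ := mul_le_mul_of_nonneg_left (mul_le_mul_of_nonneg_right hss (hc _))
              (by positivity)
        have e2 : (y 2 - x 2) ^ 2 ≤
            (κ ^ 2) ^ 2 * ((F / κ) ^ 2 * (2 - 2 * Real.cos ((y 2 - x 2) / F))) := by
          calc (y 2 - x 2) ^ 2 = F ^ 2 * ((y 2 - x 2) / F) ^ 2 := by field_simp
            _ ≤ F ^ 2 * (κ ^ 2 * (2 - 2 * Real.cos ((y 2 - x 2) / F))) := by gcongr
            _ = _ := by field_simp
        linarith
      · exact hs1.le.trans (le_mul_of_one_le_left hη.le (one_le_pow₀ hκ.le))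
    exact hfin.trans (by gcongr)

omit ha_lim in
lemma continuous_of_chart (h : IsMetric (dLim β a)) (σ F : ℝ) :
    Continuous fun x : E3 => Space.of h (chart σ F x) := by
  have hx : Continuous fun x : E3 => (x 0, x 1 / σ, x 2 / F) := by fun_prop
  have hcomp := (continuous_of_point hβ ha_pos h).comp hx
  exact hcomp

/-- The push-forward of the volume under `r` has the density `levelArea` at small scales. -/
lemma exists_local_density (h : IsMetric (dLim β a)) {ρ : ℝ} (hρ : ρ ∈ Ioo 0 Real.pi) {ε : ℝ}
    (hε : 0 < ε) :
    ∃ δ > 0, ∀ s t, ρ - δ < s → s < t → t < ρ + δ →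
      ENNReal.ofReal ((levelArea β ρ - ε) * (t - s)) ≤
          μHE[3] (Space.of h '' {p | r p ∈ Ioc s t}) ∧
        μHE[3] (Space.of h '' {p | r p ∈ Ioc s t}) ≤
          ENNReal.ofReal ((levelArea β ρ + ε) * (t - s)) := by
  have hσ : 0 < Real.sin ρ := Real.sin_pos_of_pos_of_lt_pi hρ.1 hρ.2
  have hF : 0 < warpLimit β ρ := zero_lt_one.trans_le (hβ.trans (le_warpLimit β ρ))
  have hw : 0 ≤ levelArea β ρ := by unfold levelArea; positivity
  -- the bi-Lipschitz constant is `κ ^ 2`, which enters a three-dimensional volume as `κ ^ 6`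
  obtain ⟨κ, hκw, hκ⟩ : ∃ κ : ℝ, κ ^ 6 * levelArea β ρ < levelArea β ρ + ε ∧ 1 < κ := by
    have hc : Continuous fun κ : ℝ => κ ^ 6 * levelArea β ρ := by fun_prop
    have h1 : ∀ᶠ κ in 𝓝[>] (1 : ℝ), κ ^ 6 * levelArea β ρ < levelArea β ρ + ε :=
      nhdsWithin_le_nhds (hc.continuousAt.eventually_lt_const (by simpa using hε))
    exact (h1.and self_mem_nhdsWithin).exists
  have hκ0 : 0 < κ := zero_lt_one.trans hκ
  obtain ⟨δ, hδ, hsub, δ', hδ', hbi⟩ := exists_chart_bilipschitz hβ ha_pos ha_lim hρ hκ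
  refine ⟨δ, hδ, fun s t hs hst ht => ?_⟩
  have hs0 : 0 < s := (hsub ⟨hs, hst.trans ht⟩).1
  have htπ : t < Real.pi := (hsub ⟨hs.trans hst, ht⟩).2
  set σ := Real.sin ρ
  set F := warpLimit β ρ
  have himage : Space.of h '' {p | r p ∈ Ioc s t} =
      (fun x : E3 => Space.of h (chart σ F x)) '' chartBox σ F s t := by
    rw [← chart_image hσ hF hs0.le htπ.le, image_image]
  have hbox : ∀ x ∈ chartBox σ F s t, x 0 ∈ Ioo (ρ - δ) (ρ + δ) := fun x hx =>
    ⟨hs.trans hx.1.1, hx.1.2.trans_lt ht⟩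
  have hvol : μHE[3] (chartBox σ F s t) = ENNReal.ofReal (levelArea β ρ * (t - s)) := by
    rw [EuclideanSpace.euclideanHausdorffMeasure_eq_volume, volume_chartBox hσ F hst.le]
    rfl
  have hcoe : ((Real.toNNReal (κ ^ 2) : NNReal) : ℝ) = κ ^ 2 := Real.coe_toNNReal _ (by positivity)
  have hpow : ((Real.toNNReal (κ ^ 2) : NNReal) : ENNReal) ^ 3 = ENNReal.ofReal (κ ^ 6) := by
    change ENNReal.ofReal (κ ^ 2) ^ 3 = _
    rw [← ENNReal.ofReal_pow (by positivity)]
    ring_nf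
  have hup := euclideanHausdorffMeasure_image_le_of_small_scale (measurableSet_chartBox σ F s t)
    (f := fun x => Space.of h (chart σ F x)) (K := Real.toNNReal (κ ^ 2)) hδ' (fun x hx y hy _ => by
      rw [hcoe]
      refine (hbi x y (hbox x hx) (hbox y hy)).1.trans ?_
      gcongr
      nlinarith) 3
  have hlow := euclideanHausdorffMeasure_le_image_of_small_scale (measurableSet_chartBox σ F s t)
    (f := fun x => Space.of h (chart σ F x)) (K := Real.toNNReal (κ ^ 2))
    (continuous_of_chart hβ ha_pos h σ F).continuousOn (injOn_chart hσ hF hs0.le htπ) hδ'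
    (fun x hx y hy hxy => by
      rw [hcoe]
      exact (hbi x y (hbox x hx) (hbox y hy)).2 hxy) 3
  rw [← himage, hvol, hpow] at hup hlow
  have hts : 0 ≤ t - s := sub_nonneg.2 hst.le
  have hκ6 : 1 ≤ κ ^ 6 := one_le_pow₀ hκ.le
  constructor
  · have h6 : ENNReal.ofReal (κ ^ 6) ≠ 0 := by
      rw [Ne, ENNReal.ofReal_eq_zero, not_le]; positivity
    rw [← ENNReal.mul_le_mul_iff_right h6 ENNReal.ofReal_ne_top]
    refine le_trans ?_ hlow
    rw [← ENNReal.ofReal_mul (by positivity)]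
    refine ENNReal.ofReal_le_ofReal ?_
    rw [← mul_assoc]
    gcongr
    nlinarith
  · refine hup.trans ?_
    rw [← ENNReal.ofReal_mul (by positivity)]
    refine ENNReal.ofReal_le_ofReal ?_
    rw [← mul_assoc]
    gcongr

lemma euclideanHausdorffMeasure_univ (h : IsMetric (dLim β a)) :
    μHE[3] (univ : Set (Space h)) =
      ENNReal.ofReal ((2 * Real.pi) ^ 2 * (2 * β + 4 - 2 * Real.log 4)) := by
  have hcont : Continuous fun p : Space h => r p.pt :=
    continuous_r.comp ((hasPolarModulus_dLim hβ ha_pos).homeomorph h).symm.continuous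
  have himg : ∀ A : Set ℝ, (fun p : Space h => r p.pt) ⁻¹' A = Space.of h '' {p | r p ∈ A} := by
    intro A
    ext p
    exact ⟨fun hp => ⟨p.pt, hp, rfl⟩, by rintro ⟨q, hq, rfl⟩; exact hq⟩
  have hregular : μHE[3] (Space.of h '' {p | r p ∈ Ioo 0 Real.pi}) =
      ENNReal.ofReal (levelAreaPrimitive β Real.pi - levelAreaPrimitive β 0) := by
    have hmap : ∀ A : Set ℝ, MeasurableSet A → Measure.map (fun p : Space h => r p.pt) μHE[3] A =
        μHE[3] (Space.of h '' {p | r p ∈ A}) := fun A hA => by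
      rw [Measure.map_apply hcont.measurable hA, himg]
    rw [← hmap _ measurableSet_Ioo]
    have hsin : ∀ x ∈ Ioo 0 Real.pi, 0 < Real.sin x := fun x hx =>
      Real.sin_pos_of_pos_of_lt_pi hx.1 hx.2
    refine measure_Ioo_eq_of_local_density (w := levelArea β) Real.pi_pos
      (fun x hx => hasDerivAt_levelAreaPrimitive β (hsin x hx).ne')
      (continuous_levelAreaPrimitive β) (fun x hx => ?_) fun x hx ε hε => ?_
    · have h1 := (hsin x hx).le
      have h2 := zero_le_one.trans (hβ.trans (le_warpLimit β x))
      unfold levelArea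
      positivity
    · simp only [hmap _ measurableSet_Ioc]
      exact exists_local_density hβ ha_pos ha_lim h hx hε
  have hsingular : μHE[3] (Space.of h '' S) = 0 := by
    have h3 : Measure.hausdorffMeasure ((3 : ℕ) : ℝ) (Space.of h '' S) = 0 := by
      have := hausdorffMeasure_of_dimH_lt (d := 3) (s := Space.of h '' S) (by
        rw [dimH_S hβ ha_pos ha_lim h]; norm_num)
      simpa using this
    rw [Measure.euclideanHausdorffMeasure_def, Measure.smul_apply, h3, smul_zero]
  have huniv : (univ : Set (Space h)) =
      Space.of h '' {p | r p ∈ Ioo 0 Real.pi} ∪ Space.of h '' S := by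
    rw [← image_union]
    refine (eq_univ_of_forall fun p : Space h => (mem_image _ _ _).2 ⟨p.pt, ?_, rfl⟩).symm
    by_cases hp : p.pt ∈ S
    · exact Or.inr hp
    · exact Or.inl (r_mem_Ioo hp)
  rw [← levelAreaPrimitive_sub, ← hregular]
  refine le_antisymm ?_ (measure_mono (subset_univ _))
  rw [huniv]
  exact (measure_union_le _ _).trans_eq (by rw [hsingular, add_zero])

end volume

end ExtremeLimit

end

open ExtremeLimit in
theorem theorem1p1 (β : ℝ) (hβ : 2 ≤ β) (a : ℕ → ℝ) (ha_pos : ∀ j, 0 < a j)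
    (ha_anti : Antitone a) (ha_lim : Tendsto a atTop (𝓝 0)) :
    -- the Riemannian distances are distances, and they have a pointwise limit that is one
    ∃ (h₀ : IsMetric d₀) (hj : ∀ j, IsMetric (dWarp β (a j))) (hext : IsMetric (dExtreme β))
      (dlim : M → M → ℝ) (hlim : IsMetric dlim),
      -- `d_j` increases to `d_∞`
      (∀ p q, Monotone fun j => dWarp β (a j) p q) ∧
      (∀ p q, Tendsto (fun j => dWarp β (a j) p q) atTop (𝓝 (dlim p q))) ∧
      (∀ p q, IsLUB (range fun j => dWarp β (a j) p q) (dlim p q)) ∧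
      -- uniform convergence
      TendstoUniformly (fun j (x : M × M) => dWarp β (a j) x.1 x.2) (fun x => dlim x.1 x.2)
        atTop ∧
      -- compactness and Gromov–Hausdorff convergence
      (∃ (_ : ∀ j, CompactSpace (Space (hj j))) (_ : CompactSpace (Space hlim)),
        Tendsto (fun j => GromovHausdorff.ghDist (Space (hj j)) (Space hlim)) atTop (𝓝 0)) ∧
      -- the identity map is a homeomorphism from the isometric product to the limit space
      IsHomeomorph (fun p : Space h₀ => Space.of hlim p.pt) ∧
      -- the limit space, with the inclusion, is the metric completion of the extreme limit
      CompleteSpace (Space hlim) ∧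
      Isometry (fun p : Space hext => Space.of hlim (p.pt : M)) ∧
      DenseRange (fun p : Space hext => Space.of hlim (p.pt : M)) ∧
      -- the singular set has Hausdorff dimension one and infinite one-dimensional measure
      dimH (Space.of hlim '' S) = 1 ∧
      μHE[1] (Space.of hlim '' S) = ⊤ ∧
      -- each of the two singular fibres is unrectifiable
      (∀ ρ ∈ ({0, Real.pi} : Set ℝ),
        μHE[1] (Space.of hlim '' fibre ρ) = ⊤ ∧
        eVariationOn (fun t => Space.of hlim (point ρ 0 t)) (Icc 0 (2 * Real.pi)) = ⊤) ∧
      -- the total volume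
      μHE[3] (univ : Set (Space hlim)) =
        ENNReal.ofReal ((2 * Real.pi) ^ 2 * (2 * β + 4 - 2 * Real.log 4)) := by
  have hβ1 : 1 ≤ β := by linarith
  have hd := hasPolarModulus_dLim hβ1 ha_pos
  have hlim := isMetric_dLim hβ1 ha_pos
  have hdj := fun j => hasPolarModulus_dWarp hβ1 (ha_pos j)
  have hj := fun j => isMetric_dWarp hβ1 (ha_pos j)
  have hext := isMetric_dExtreme hβ1
  have hu := tendstoUniformly_dWarp hβ1 ha_pos ha_anti
  have := fun j => (hdj j).compactSpace (hj j)
  have := hd.compactSpace hlim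
  exact ⟨isMetric_d₀, hj, hext, dLim β a, hlim, monotone_dWarp hβ1 ha_pos ha_anti,
    tendsto_dWarp hβ1 ha_pos ha_anti, isLUB_dLim hβ1 ha_pos, hu,
    ⟨inferInstance, inferInstance, tendsto_ghDist hj hlim hu⟩,
    (hasPolarModulus_d₀ hβ1).isHomeomorph hd isMetric_d₀ hlim, inferInstance,
    isometry_dExtreme_dLim hβ1 ha_pos ha_lim hext hlim, denseRange_inclusion hd hlim hext,
    dimH_S hβ1 ha_pos ha_lim hlim, euclideanHausdorffMeasure_S hβ1 ha_pos ha_lim hlim,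
    fun ρ hρ => ⟨euclideanHausdorffMeasure_fibre hβ1 ha_pos ha_lim hlim hρ,
      eVariationOn_fibre hβ1 ha_pos ha_lim hlim hρ⟩,
    euclideanHausdorffMeasure_univ hβ1 ha_pos ha_lim hlim⟩
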